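/- Conventions. A second order linear equation $y''+p(z)y'+q(z)y=0$ on the Riemann sphere $\overline{\mathbb C}$ is *Fuchsian* at a point if there, written in a local coordinate $t$ centred at the point ($t=z-a$, or $t=1/z$ at $\infty$), the coefficients of $dy/dt$ and of $y$ have poles of order at most $1$ and $2$; the point is *singular* if these coefficients are not both holomorphic there. A *Riemann equation* with singular set $\mathcal D$ is an equation that is Fuchsian at the points of $\mathcal D$ and whose singular points are exactly the points of $\mathcal D$, where $|\mathcal D|=3$. A *Riemann–Sturm–Liouville (RSL) equation* is a Riemann equation with $p\equiv 0$, i.e. $y''+q(z)y=0$. The equation has *monodromy* $\chi:\pi_1(\overline{\mathbb C}\setminus\mathcal D,x_0)\to SL(2,\mathbb C)$ if for some fundamental system $Y=(y_1,y_2)$ of germs of solutions at $x_0$ the analytic continuation $Y^*$ of $Y$ along every loop $\gamma$ satisfies $Y=Y^*\chi([\gamma])$ (in a product $\gamma_1\gamma_2$ the loop $\gamma_1$ is traversed first). The *exponents* $\beta_a^1,\beta_a^2$ of the equation at $a\in\mathcal D$ are $\beta_a^j=\varphi_a^j+\rho_a^j$. Here, for a multivalued function $f$ near $a$, with $t$ the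 local coordinate, the Levelt valuation $\varphi_a(f)$ is the largest $k\in\mathbb Z$ such that $f/t^{\lambda}\to0$ as $t\to 0$ in every sector of opening less than $2\pi$, for every real $\lambda<k$; $\varphi_a^1\ge\varphi_a^2$ are the valuations of a basis $(e_1,e_2)$ of the local solution space on which the valuation takes all its values with multiplicities and in which the matrix $G$ of the local monodromy operator $g^*$ (one counter-clockwise turn around $a$, $(g^*e_1,g^*e_2)=(e_1,e_2)G$) is upper triangular; and $e^{2\pi i\rho_a^j}=G_{jj}$ with $0\le\operatorname{Re}\rho_a^j<1$. Statement. Let $\mathcal D\subset\overline{\mathbb C}$ be a set of three points, $x_0\notin\mathcal D$, and let $\chi:\pi_1(\overline{\mathbb C}\setminus\mathcal D,x_0)\to SL(2,\mathbb C)$ be a representation. The following are equivalent: 1. $\chi$ is realized, up to a conformal automorphism of the sphere, by the monodromy of an RSL equation: there are a Möbius transformation $\phi$ and an RSL equation with singular set $\phi(\mathcal D)$ that has a monodromy $\psi:\pi_1(\overline{\mathbb C}\setminus\phi(\mathcal D),\phi(x_0))\to SL(2,\mathbb C)$ with $\chi=\psi\circ\phi_*$. 2. There is a Riemann equation with singular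 set $\mathcal D$ and monodromy $\chi$ such that $\beta_a^1+\beta_a^2=1$ and $\beta_b^1+\beta_b^2=1$ for two distinct points $a,b\in\mathcal D$. -/

import Mathlib

open Filter Topology Complex OnePoint
open scoped Matrix

/-! ### The Riemann sphere and holomorphic germs on it

The Riemann sphere is the one-point compactification `OnePoint ℂ`. -/

/-- The standard local parametrization `t ↦ x + t` (`t ↦ 1 / t` if `x = ∞`) of the sphere,
which sends `0` to `x`. -/
noncomputable def sphereParam : OnePoint ℂ → ℂ → OnePoint ℂ
  | ∞, t => if t = 0 then ∞ else ((t⁻¹ : ℂ) : OnePoint ℂ)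
  | (a : ℂ), t => ((a + t : ℂ) : OnePoint ℂ)

/-- `f` is holomorphic in a neighbourhood of the point `x` of the sphere. -/
def HolomorphicNear (f : OnePoint ℂ → ℂ) (x : OnePoint ℂ) : Prop :=
  AnalyticAt ℂ (fun t => f (sphereParam x t)) 0

/-- The germ of `g` at the end point of `γ` is the analytic continuation along `γ` of the germ
of `f` at the initial point: there is a family of holomorphic germs `F t` at `γ t`, locally
constant in `t`, which starts at `f` and ends at `g`. -/
def ContinuesAlong (γ : unitInterval → OnePoint ℂ) (f g : OnePoint ℂ → ℂ) : Prop :=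
  ∃ F : unitInterval → OnePoint ℂ → ℂ,
    (∀ t, HolomorphicNear (F t) (γ t)) ∧
    (∀ t, ∀ᶠ s in 𝓝 t, F s =ᶠ[𝓝 (γ s)] F t) ∧
    F 0 =ᶠ[𝓝 (γ 0)] f ∧ F 1 =ᶠ[𝓝 (γ 1)] g

/-! ### Second order linear equations -/

/-- The equation `y'' + p y' + q y = 0` on the sphere, with affine coordinate `z`. -/
structure LinearEquation where
  p : ℂ → ℂ
  q : ℂ → ℂ

namespace LinearEquation

/-- The coefficient of `dy/dt` when the equation is written as
`d²y/dt² + P dy/dt + Q y = 0` in the local coordinate `t` at `x`. -/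
noncomputable def pAt (E : LinearEquation) : OnePoint ℂ → ℂ → ℂ
  | ∞, t => 2 / t - E.p t⁻¹ / t ^ 2
  | (a : ℂ), t => E.p (a + t)

/-- The coefficient of `y` when the equation is written as
`d²y/dt² + P dy/dt + Q y = 0` in the local coordinate `t` at `x`. -/
noncomputable def qAt (E : LinearEquation) : OnePoint ℂ → ℂ → ℂ
  | ∞, t => E.q t⁻¹ / t ^ 4
  | (a : ℂ), t => E.q (a + t)

/-- The coefficients at `x` have poles of order at most `1` and `2`. -/
def IsFuchsianAt (E : LinearEquation) (x : OnePoint ℂ) : Prop :=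
  MeromorphicAt (E.pAt x) 0 ∧ MeromorphicAt (E.qAt x) 0 ∧
    -1 ≤ meromorphicOrderAt (E.pAt x) 0 ∧ -2 ≤ meromorphicOrderAt (E.qAt x) 0

/-- `x` is not a singular point: both coefficients extend holomorphically to `x`. -/
def IsOrdinaryAt (E : LinearEquation) (x : OnePoint ℂ) : Prop :=
  MeromorphicAt (E.pAt x) 0 ∧ MeromorphicAt (E.qAt x) 0 ∧
    0 ≤ meromorphicOrderAt (E.pAt x) 0 ∧ 0 ≤ meromorphicOrderAt (E.qAt x) 0

/-- `E` is a Riemann equation with set of singular points `D`: it is Fuchsian, and its singular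
points are exactly the points of `D`, of which there are three. The values of the coefficient
functions at the points of `D` carry no meaning; at the other finite points the coefficients
are holomorphic as they stand. -/
structure IsRiemann (E : LinearEquation) (D : Set (OnePoint ℂ)) : Prop where
  card : D.ncard = 3
  fuchsian : ∀ x ∈ D, E.IsFuchsianAt x
  singular : ∀ x ∈ D, ¬ E.IsOrdinaryAt x
  ordinary : ∀ x ∉ D, E.IsOrdinaryAt x
  analytic : ∀ z : ℂ, (z : OnePoint ℂ) ∉ D → AnalyticAt ℂ E.p z ∧ AnalyticAt ℂ E.q z

/-- `E` is a Riemann–Sturm–Liouville equation with set of singular points `D`: a Riemann equation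
of the form `y'' + q y = 0`. -/
structure IsRiemannSturmLiouville (E : LinearEquation) (D : Set (OnePoint ℂ)) : Prop where
  riemann : E.IsRiemann D
  no_first_order_term : ∀ z : ℂ, (z : OnePoint ℂ) ∉ D → E.p z = 0

/-! ### Monodromy -/

/-- `f` is a holomorphic solution of the equation in a neighbourhood of `x`. -/
def IsSolutionNear (E : LinearEquation) (f : OnePoint ℂ → ℂ) (x : OnePoint ℂ) : Prop :=
  ∀ᶠ y in 𝓝 x, HolomorphicNear f y ∧ ∀ z : ℂ, y = (z : OnePoint ℂ) →
    deriv (deriv fun u : ℂ => f u) z + E.p z * deriv (fun u : ℂ => f u) z + E.q z * f z = 0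

/-- `Y = (Y 0, Y 1)` is a fundamental system of germs of solutions at `x`. -/
def IsFundamentalNear (E : LinearEquation) (Y : Fin 2 → OnePoint ℂ → ℂ) (x : OnePoint ℂ) : Prop :=
  (∀ j, E.IsSolutionNear (Y j) x) ∧
    ∀ c : Fin 2 → ℂ, (∀ᶠ y in 𝓝 x, ∑ j, c j * Y j y = 0) → c = 0

/-- `χ` is the monodromy representation of `E` for some fundamental system `Y` of solutions at
the base point: the continuation `Z` of `Y` along a loop `γ` satisfies `Y = Z χ([γ])`.

Loops are composed in the order in which they are written (first `γ₁`, then `γ₂` in `γ₁ γ₂`),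
so that this formula defines a homomorphism. This is the opposite of Mathlib's order
(`FundamentalGroup.mul_def`), hence the opposite group. -/
def HasMonodromy (E : LinearEquation) {D : Set (OnePoint ℂ)} {x₀ : ↥Dᶜ}
    (χ : (FundamentalGroup ↥Dᶜ x₀)ᵐᵒᵖ →* Matrix.SpecialLinearGroup (Fin 2) ℂ) : Prop :=
  ∃ Y : Fin 2 → OnePoint ℂ → ℂ, E.IsFundamentalNear Y x₀ ∧
    ∀ γ : Path x₀ x₀, ∃ Z : Fin 2 → OnePoint ℂ → ℂ,
      (∀ j, ContinuesAlong (fun t => (γ t : OnePoint ℂ)) (Y j) (Z j)) ∧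
      ∀ᶠ y in 𝓝 (x₀ : OnePoint ℂ), ∀ j, Y j y =
        ∑ k, Z k y * (χ (MulOpposite.op (FundamentalGroup.fromPath ⟦γ⟧))).val k j

/-! ### Levelt valuation and exponents

Multivalued functions on a punctured disc `0 < |t| < exp R` are written as functions of
`s = log t` on the half plane `re s < R`. The monodromy operator of one counter-clockwise turn
is `F ↦ F (· + 2 π i)`. -/

end LinearEquation

/-- `valuation F ≥ k`: for every real `l < k`, `F / t ^ l → 0` as `t = exp s → 0` in every sector
of opening less than `2 π`. -/
def LeveltGE (F : ℂ → ℂ) (k : ℤ) : Prop :=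
  ∀ l : ℝ, l < k → ∀ c d : ℝ, d - c < 2 * Real.pi →
    Tendsto (fun s : ℂ => F s * exp (-(l : ℂ) * s))
      (comap Complex.re atBot ⊓ 𝓟 {s : ℂ | c < s.im ∧ s.im < d}) (𝓝 0)

/-- The Levelt valuation of `F` is the integer `k`. -/
def HasLeveltValuation (F : ℂ → ℂ) (k : ℤ) : Prop :=
  IsGreatest {m : ℤ | LeveltGE F m} k

namespace LinearEquation

/-- `F` is a (multivalued) solution on the punctured disc `0 < |t| < exp R`, where `t` is the local
coordinate at `x`. With `F s = y (exp s)` one has `t y' = F'` and `t² y'' = F'' - F'`. -/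
def IsMultivaluedSolution (E : LinearEquation) (x : OnePoint ℂ) (R : ℝ) (F : ℂ → ℂ) : Prop :=
  ∀ s : ℂ, s.re < R → AnalyticAt ℂ F s ∧
    (deriv (deriv F) s - deriv F s) + exp s * E.pAt x (exp s) * deriv F s
      + exp s ^ 2 * E.qAt x (exp s) * F s = 0

/-- `(e 0, e 1)` is a basis of the two-dimensional space of solutions near the singular point `x`,
associated at `x`, with valuations `v` and (upper triangular) monodromy matrix `G`. -/
structure IsAssociatedBasis (E : LinearEquation) (x : OnePoint ℂ) (R : ℝ)
    (e : Fin 2 → ℂ → ℂ) (v : Fin 2 → ℤ) (G : Matrix (Fin 2) (Fin 2) ℂ) : Prop where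
  solution : ∀ j, E.IsMultivaluedSolution x R (e j)
  independent : ∀ c : Fin 2 → ℂ, (∀ s : ℂ, s.re < R → ∑ j, c j * e j s = 0) → c = 0
  valuation : ∀ j, HasLeveltValuation (e j) (v j)
  /-- The valuation takes all its values on the basis, with multiplicities: every step
  `{f | valuation f ≥ k}` of the filtration is spanned by the basis vectors in it. -/
  adapted : ∀ (c : Fin 2 → ℂ) (k : ℤ), LeveltGE (fun s => ∑ j, c j * e j s) k →
    ∀ j, c j ≠ 0 → k ≤ v j
  decreasing : v 1 ≤ v 0
  monodromy : ∀ s : ℂ, s.re < R → ∀ k,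
    e k (s + 2 * Real.pi * I) = ∑ j, e j s * G j k
  triangular : G 1 0 = 0

/-- `β 0`, `β 1` are the exponents of the equation at `x`: `β j = v j + ρ j`, where `v j` are the
valuations of an associated basis and `ρ j`, with `0 ≤ re (ρ j) < 1`, are the normalized logarithms
`(2 π i)⁻¹ log` of the diagonal entries of the local monodromy matrix in that basis. -/
def HasExponents (E : LinearEquation) (x : OnePoint ℂ) (β : Fin 2 → ℂ) : Prop :=
  ∃ (R : ℝ) (e : Fin 2 → ℂ → ℂ) (v : Fin 2 → ℤ) (G : Matrix (Fin 2) (Fin 2) ℂ) (ρ : Fin 2 → ℂ),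
    E.IsAssociatedBasis x R e v G ∧
    (∀ j, exp (2 * Real.pi * I * ρ j) = G j j ∧ 0 ≤ (ρ j).re ∧ (ρ j).re < 1) ∧
    ∀ j, β j = v j + ρ j

end LinearEquation

/-! ### Conformal maps of the sphere and realizability -/

/-- `φ` is a conformal automorphism (a Möbius transformation) of the sphere. -/
def IsMobius (φ : OnePoint ℂ ≃ₜ OnePoint ℂ) : Prop :=
  ∃ g : GL (Fin 2) ℂ, ∀ z, φ z = g • z

/-- The restriction of a homeomorphism of the sphere to the complement of `D`. -/
noncomputable def puncturedMap (φ : OnePoint ℂ ≃ₜ OnePoint ℂ) (D : Set (OnePoint ℂ)) :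
    C(↥Dᶜ, ↥(φ '' D)ᶜ) where
  toFun x := ⟨φ x, fun ⟨_, hy, h⟩ => x.2 (φ.injective h ▸ hy)⟩
  continuous_toFun := (φ.continuous.comp continuous_subtype_val).subtype_mk _

/-- `χ` is realized by the monodromy of a Riemann–Sturm–Liouville equation, up to a conformal
change of coordinate on the sphere: for some Möbius transformation `φ`, such an equation with
set of singular points `φ(D)` has a monodromy representation `ψ` on the complement of `φ(D)`
which corresponds to `χ` under `φ`. -/
def RealizableByRSL {D : Set (OnePoint ℂ)} {x₀ : ↥Dᶜ}
    (χ : (FundamentalGroup ↥Dᶜ x₀)ᵐᵒᵖ →* Matrix.SpecialLinearGroup (Fin 2) ℂ) : Prop :=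
  ∃ φ : OnePoint ℂ ≃ₜ OnePoint ℂ, IsMobius φ ∧
    ∃ E : LinearEquation, E.IsRiemannSturmLiouville (φ '' D) ∧
      ∃ ψ : (FundamentalGroup ↥(φ '' D)ᶜ (puncturedMap φ D x₀))ᵐᵒᵖ →*
          Matrix.SpecialLinearGroup (Fin 2) ℂ,
        E.HasMonodromy ψ ∧
        χ = ψ.comp (MonoidHom.op (FundamentalGroup.map (puncturedMap φ D) x₀))

/-!
A condition on exponents is turned into a condition on the first order coefficient, and the latter
is compared on the two sides of the equivalence.

**Local part.** At a Fuchsian point `t P` and `t² Q` are holomorphic, and in the coordinate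
`s = log t` the equation is `F'' + A(exp s) F' + B(exp s) F = 0` with `A = t P - 1`, `B = t² Q`.
Let `l` and `l - μ`, `re μ ≥ 0`, be the roots of the indicial equation `X² + A(0) X + B(0) = 0`.
There is a solution `t ^ l h(t)`, whose power series converges because the recursion divides by
`n (n + μ)`, of modulus at least `n²` (`exists_frobenius`). Reduction of order gives a second
solution `t ^ (l - μ) H(t) + c log t · t ^ l h(t)`, with a logarithm only if `μ` is a natural
number (`exists_isFrobeniusPair`). These two solutions are an associated basis with exponents `l`
and `l - μ` (`isAssociatedBasis_of_isFrobeniusPair`), whose sum is `-A(0) = 1 - res P`. The sum of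
the exponents does not depend on the associated basis: the sum of the valuations is determined by
the filtration and the eigenvalues by the monodromy operator
(`IsAssociatedBasis.exponent_sum_unique`). Hence the exponents at a Fuchsian point have sum `1` if
and only if `P` has no pole there (`exponent_sum_eq_one_iff`).

**Global part.** A Möbius transformation pulls back equations, and in local coordinates the
pull-back is again given by a Möbius transformation, one that fixes `0`
(`pull_eventuallyEq`). So it preserves Fuchsian and ordinary points, the absence of a pole of the
first order coefficient, solutions, and monodromy (`IsRiemann.pull`, `HasMonodromy.pull`).

An equation `y'' + q y = 0` has a singular point at `∞`, because in the coordinate `1 / z` it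
acquires the first order coefficient `2 / t`; at its two finite singular points the first order
coefficient has no pole. Pulling back gives one implication. Conversely, if the exponents at two
singular points have sum `1`, the third one is moved to `∞`. The first order coefficient is then
entire, and tends to `0` at the Fuchsian point `∞`, so that it vanishes by Liouville's theorem
(`IsRiemann.isRiemannSturmLiouville`).
-/


/-! ### Power series at the origin -/

/-- The sequence `c` is the sequence of Taylor coefficients of `f` at `0`, and the Taylor series
represents `f` in a neighbourhood of `0`. -/
def HasTaylor (c : ℕ → ℂ) (f : ℂ → ℂ) : Prop :=
  ∀ᶠ t in 𝓝 (0 : ℂ), HasSum (fun n => c n * t ^ n) (f t)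

theorem hasTaylor_iff {c : ℕ → ℂ} {f : ℂ → ℂ} :
    HasTaylor c f ↔ HasFPowerSeriesAt f (FormalMultilinearSeries.ofScalars ℂ c) 0 := by
  rw [hasFPowerSeriesAt_iff]
  simp only [FormalMultilinearSeries.coeff_ofScalars, zero_add, smul_eq_mul, HasTaylor, mul_comm]

theorem HasTaylor.analyticAt {c : ℕ → ℂ} {f : ℂ → ℂ} (h : HasTaylor c f) : AnalyticAt ℂ f 0 :=
  (hasTaylor_iff.1 h).analyticAt

theorem AnalyticAt.exists_hasTaylor {f : ℂ → ℂ} (h : AnalyticAt ℂ f 0) : ∃ c, HasTaylor c f := by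
  obtain ⟨p, hp⟩ := h
  refine ⟨fun n => p.coeff n, ?_⟩
  rw [hasFPowerSeriesAt_iff] at hp
  simpa only [HasTaylor, zero_add, smul_eq_mul, mul_comm] using hp

theorem HasTaylor.apply_zero {c : ℕ → ℂ} {f : ℂ → ℂ} (h : HasTaylor c f) : f 0 = c 0 := by
  have h0 := h.self_of_nhds
  have h1 : HasSum (fun n => c n * (0 : ℂ) ^ n) (c 0) := by
    convert hasSum_ite_eq 0 (c 0) using 2 with n
    by_cases hn : n = 0 <;> simp [hn]
  exact h0.unique h1

theorem HasTaylor.eventuallyEq {c : ℕ → ℂ} {f g : ℂ → ℂ} (hf : HasTaylor c f)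
    (hg : HasTaylor c g) : f =ᶠ[𝓝 0] g := by
  filter_upwards [hf, hg] with t h1 h2 using h1.unique h2

theorem HasTaylor.add {c d : ℕ → ℂ} {f g : ℂ → ℂ} (hf : HasTaylor c f) (hg : HasTaylor d g) :
    HasTaylor (fun n => c n + d n) (fun t => f t + g t) := by
  filter_upwards [hf, hg] with t h1 h2
  simpa only [add_mul] using h1.add h2

theorem HasTaylor.const_mul {c : ℕ → ℂ} {f : ℂ → ℂ} (a : ℂ) (hf : HasTaylor c f) :
    HasTaylor (fun n => a * c n) (fun t => a * f t) := by
  filter_upwards [hf] with t h1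
  simpa only [mul_assoc] using h1.mul_left a

theorem HasTaylor.mul {c d : ℕ → ℂ} {f g : ℂ → ℂ} (hf : HasTaylor c f) (hg : HasTaylor d g) :
    HasTaylor (fun n => ∑ k ∈ Finset.HasAntidiagonal.antidiagonal n, c k.1 * d k.2)
      (fun t => f t * g t) := by
  filter_upwards [hf, hg] with t h1 h2
  have s1 := summable_norm_iff.2 h1.summable
  have s2 := summable_norm_iff.2 h2.summable
  have key := tsum_mul_tsum_eq_tsum_sum_antidiagonal_of_summable_norm s1 s2
  have s3 := (summable_norm_sum_mul_antidiagonal_of_summable_norm s1 s2).of_norm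
  rw [h1.tsum_eq, h2.tsum_eq] at key
  have := s3.hasSum
  rw [← key] at this
  refine Eq.subst (motive := fun u => HasSum u _) (funext fun n => ?_) this
  rw [Finset.sum_mul]
  refine Finset.sum_congr rfl fun k hk => ?_
  rw [← Finset.HasAntidiagonal.mem_antidiagonal.1 hk, pow_add]
  ring

/-- The Euler operator `t d/dt` multiplies the `n`-th Taylor coefficient by `n`. -/
theorem HasTaylor.euler {c : ℕ → ℂ} {f : ℂ → ℂ} (hf : HasTaylor c f) :
    HasTaylor (fun n => n * c n) (fun t => t * deriv f t) := by
  obtain ⟨r, hr⟩ := hasTaylor_iff.1 hf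
  have h1 := (ContinuousLinearMap.apply ℂ ℂ (1 : ℂ)).comp_hasFPowerSeriesOnBall hr.fderiv
  have h2 := hasFPowerSeriesAt_iff.1 h1.hasFPowerSeriesAt
  filter_upwards [h2] with t ht
  simp only [zero_add] at ht
  have h3 := ht.mul_left t
  rw [hasSum_nat_add_iff' (f := fun n => (n : ℂ) * c n * t ^ n) 1 |>.symm]
  simp only [Finset.range_one, Finset.sum_singleton, Nat.cast_zero, zero_mul, sub_zero]
  refine Eq.subst (motive := fun u => HasSum u _) (funext fun n => ?_) h3
  have : ((ContinuousLinearMap.apply ℂ ℂ (1:ℂ)).compFormalMultilinearSeries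
      (FormalMultilinearSeries.ofScalars ℂ c).derivSeries).coeff n
      = ((n : ℂ) + 1) * c (n + 1) := by
    have := FormalMultilinearSeries.derivSeries_coeff_one (FormalMultilinearSeries.ofScalars ℂ c) n
    rw [FormalMultilinearSeries.coeff_ofScalars] at this
    refine this.trans ?_
    rw [nsmul_eq_mul]
    push_cast
    rfl
  rw [this]
  simp [pow_succ]
  ring

theorem HasTaylor.exists_norm_le {c : ℕ → ℂ} {f : ℂ → ℂ} (hf : HasTaylor c f) :
    ∃ C K : ℝ, 0 < C ∧ 0 < K ∧ ∀ n, ‖c n‖ ≤ C * K ^ n := by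
  obtain ⟨ε, hε, h⟩ := Metric.eventually_nhds_iff.1 hf
  have hr : HasSum (fun n => c n * ((ε / 2 : ℝ) : ℂ) ^ n) (f ((ε / 2 : ℝ) : ℂ)) := by
    apply h
    simp only [dist_zero_right, norm_real, Real.norm_eq_abs]
    rw [abs_of_pos] <;> linarith
  obtain ⟨C, hC⟩ := isBounded_iff_forall_norm_le.1
    (Metric.isBounded_range_of_tendsto _ hr.summable.tendsto_atTop_zero)
  refine ⟨max C 1, (ε / 2)⁻¹, by positivity, by positivity, fun n => ?_⟩
  have h1 : ‖c n‖ * (ε / 2) ^ n ≤ C := by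
    have := hC _ ⟨n, rfl⟩
    simpa [abs_of_pos hε] using this
  rw [inv_pow, ← div_eq_mul_inv, le_div_iff₀ (by positivity)]
  exact h1.trans (le_max_left _ _)

theorem exists_hasTaylor_of_norm_le {c : ℕ → ℂ} {C K : ℝ} (hK : 0 < K)
    (h : ∀ n, ‖c n‖ ≤ C * K ^ n) : ∃ f, HasTaylor c f := by
  refine ⟨fun t => ∑' n, c n * t ^ n, ?_⟩
  filter_upwards [Metric.ball_mem_nhds (0 : ℂ) (inv_pos.2 hK)] with t ht
  refine Summable.hasSum (Summable.of_norm_bounded (g := fun n => C * (K * ‖t‖) ^ n) ?_ ?_)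
  · refine (summable_geometric_of_lt_one (by positivity) ?_).mul_left C
    rw [mem_ball_zero_iff] at ht
    calc K * ‖t‖ < K * K⁻¹ := by gcongr
      _ = 1 := mul_inv_cancel₀ hK.ne'
  · intro n
    rw [norm_mul, norm_pow, mul_pow, ← mul_assoc]
    gcongr
    exact h n

theorem hasTaylor_pow (a : ℂ) (m : ℕ) :
    HasTaylor (fun n => if n = m then a else 0) (fun t => a * t ^ m) := by
  refine Eventually.of_forall fun t => ?_
  convert hasSum_ite_eq m (a * t ^ m) using 2 with n
  by_cases hn : n = m <;> simp [hn]

/-! ### Singular first order and second order equations -/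

/-- The equation `t H' - μ H = g` can be solved by holomorphic `H` after subtracting from `g` the
resonant monomial, which is present only if `μ` is a natural number. The coefficients are
`Hₙ = gₙ / (n - μ)`, with the value `0` of a division by `0` at the resonance `n = μ`. -/
theorem exists_euler_sub_eq {g : ℂ → ℂ} (hg : AnalyticAt ℂ g 0) (μ : ℂ) :
    ∃ H : ℂ → ℂ, ∃ c : ℂ, ∃ m : ℕ, AnalyticAt ℂ H 0 ∧ (c ≠ 0 → μ = m) ∧ (μ = 0 → c = g 0) ∧
      (∀ᶠ t in 𝓝 (0 : ℂ), t * deriv H t - μ * H t = g t - c * t ^ m) := by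
  obtain ⟨a, ha⟩ := hg.exists_hasTaylor
  obtain ⟨C, K, hC, hK, hle⟩ := ha.exists_norm_le
  have hlim : Tendsto (fun n : ℕ => ((n : ℂ) - μ)⁻¹) atTop (𝓝 0) := by
    refine tendsto_inv₀_cobounded.comp ?_
    have h1 : Tendsto (fun n : ℕ => (n : ℂ)) atTop (Bornology.cobounded ℂ) := by
      rw [← tendsto_norm_atTop_iff_cobounded]
      simpa using tendsto_natCast_atTop_atTop (R := ℝ)
    simpa [sub_eq_add_neg, Function.comp_def] using (tendsto_add_const_cobounded (-μ)).comp h1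
  obtain ⟨M, hM⟩ := isBounded_iff_forall_norm_le.1 (Metric.isBounded_range_of_tendsto _ hlim)
  obtain ⟨H, hH⟩ := exists_hasTaylor_of_norm_le (c := fun n => a n * ((n : ℂ) - μ)⁻¹) (C := C * M)
    hK fun n => by
      have h2 : ‖((n : ℂ) - μ)⁻¹‖ ≤ M := hM _ ⟨n, rfl⟩
      calc ‖a n * ((n : ℂ) - μ)⁻¹‖ ≤ (C * K ^ n) * M := by
            rw [norm_mul]; gcongr; exact hle n
        _ = C * M * K ^ n := by ring
  have key := hH.euler.add (hH.const_mul (-μ))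
  by_cases hμ : ∃ m : ℕ, μ = m
  · obtain ⟨m, rfl⟩ := hμ
    refine ⟨H, a m, m, hH.analyticAt, fun _ => rfl, fun h => ?_, ?_⟩
    · rw [ha.apply_zero, Nat.cast_eq_zero.1 h]
    · have h3 := ha.add (hasTaylor_pow (-a m) m)
      have h4 : (fun n : ℕ => (n : ℂ) * (a n * ((n : ℂ) - m)⁻¹) +
          -(m : ℂ) * (a n * ((n : ℂ) - m)⁻¹)) = fun n => a n + if n = m then -a m else 0 := by
        ext n
        by_cases hn : n = m
        · simp [hn]
        · have : (n : ℂ) - m ≠ 0 := sub_ne_zero.2 (by exact_mod_cast hn)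
          simp only [hn, if_false]
          field_simp
          ring
      rw [h4] at key
      filter_upwards [key.eventuallyEq h3] with t ht
      linear_combination ht
  · refine ⟨H, 0, 0, hH.analyticAt, fun h => absurd rfl h,
      fun h => absurd ⟨0, by simpa using h⟩ hμ, ?_⟩
    have h4 : (fun n : ℕ => (n : ℂ) * (a n * ((n : ℂ) - μ)⁻¹) +
        -μ * (a n * ((n : ℂ) - μ)⁻¹)) = a := by
      ext n
      have : (n : ℂ) - μ ≠ 0 := sub_ne_zero.2 fun h => hμ ⟨n, h.symm⟩
      field_simp
      ring
    rw [h4] at key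
    filter_upwards [key.eventuallyEq ha] with t ht
    linear_combination ht

/-- The coefficients of the Frobenius series: for the equation `θ²y + a(t) θy + b(t) y = 0` with
`θ = t d/dt`, the series `t ^ l ∑ cₙ tⁿ` is a formal solution if `l` and `l - μ` are the
roots of the indicial equation. -/
noncomputable def frobeniusCoeff (a b : ℕ → ℂ) (l μ : ℂ) : ℕ → ℂ
  | 0 => 1
  | n + 1 => -(∑ k : Fin (n + 1), (a (n + 1 - k) * (l + (k : ℕ)) + b (n + 1 - k)) *
      frobeniusCoeff a b l μ k) / ((n + 1) * (n + 1 + μ))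
decreasing_by exact k.2

/-- Geometric growth: if `‖cₖ‖ ≤ L ^ k` for `k ≤ n`, each of the `n + 1` terms of the recursion is
`O((n + 1) L ^ n)`, and the divisor has modulus at least `(n + 1)²`. -/
theorem norm_frobeniusCoeff_le {a b : ℕ → ℂ} {l μ : ℂ} (hμ : 0 ≤ μ.re) {C K : ℝ}
    (hC : 0 < C) (hK : 0 < K) (ha : ∀ n, ‖a n‖ ≤ C * K ^ n) (hb : ∀ n, ‖b n‖ ≤ C * K ^ n) (n : ℕ) :
    ‖frobeniusCoeff a b l μ n‖ ≤ (K + C * (‖l‖ + 2) * K) ^ n := by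
  set L := K + C * (‖l‖ + 2) * K with hL
  have hKL : K ≤ L := by rw [hL]; have : 0 ≤ C * (‖l‖ + 2) * K := by positivity
                         linarith
  have hL0 : 0 < L := hK.trans_le hKL
  induction n using Nat.strong_induction_on with
  | _ n ih =>
    rcases n with _ | n
    · simp [frobeniusCoeff]
    · rw [frobeniusCoeff, norm_div, norm_neg, norm_mul]
      have h1 : ((n : ℝ) + 1) ≤ ‖(n : ℂ) + 1 + μ‖ := by
        refine le_trans ?_ (Complex.re_le_norm _)
        simpa using hμ
      have h2 : ‖(n : ℂ) + 1‖ = (n : ℝ) + 1 := by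
        rw [← Nat.cast_succ, norm_natCast]; simp
      have hn : (0 : ℝ) < n + 1 := by positivity
      have h3 : ‖∑ k : Fin (n + 1), (a (n + 1 - k) * (l + (k : ℕ)) + b (n + 1 - k)) *
          frobeniusCoeff a b l μ k‖ ≤ ∑ k : Fin (n + 1), C * ((‖l‖ + 2) * (n + 1)) * K * L ^ n := by
        refine norm_sum_le_of_le _ fun k _ => ?_
        have hk : (k : ℕ) ≤ n := by omega
        rw [norm_mul]
        have e1 : ‖a (n + 1 - k) * (l + (k : ℕ)) + b (n + 1 - k)‖
            ≤ C * ((‖l‖ + 2) * (n + 1)) * K ^ (n + 1 - (k : ℕ)) := by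
          have e2 : ‖l + (k : ℕ)‖ ≤ ‖l‖ + n := by
            refine (norm_add_le _ _).trans ?_
            rw [norm_natCast]
            have : ((k : ℕ) : ℝ) ≤ n := by exact_mod_cast hk
            linarith
          calc _ ≤ ‖a (n + 1 - k)‖ * ‖l + (k : ℕ)‖ + ‖b (n + 1 - k)‖ := by
                rw [← norm_mul]; exact norm_add_le _ _
            _ ≤ (C * K ^ (n + 1 - (k : ℕ))) * (‖l‖ + n) + C * K ^ (n + 1 - (k : ℕ)) := by
                gcongr
                · exact ha _
                · exact hb _
            _ = C * (‖l‖ + n + 1) * K ^ (n + 1 - (k : ℕ)) := by ring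
            _ ≤ _ := by
                gcongr
                have := norm_nonneg l
                nlinarith [mul_nonneg this (Nat.cast_nonneg (α := ℝ) n),
                  Nat.cast_nonneg (α := ℝ) n]
        calc _ ≤ (C * ((‖l‖ + 2) * (n + 1)) * K ^ (n + 1 - (k : ℕ))) * L ^ (k : ℕ) := by
              gcongr
              exact ih k (by omega)
          _ = (C * ((‖l‖ + 2) * (n + 1)) * K) * (K ^ (n - (k : ℕ)) * L ^ (k : ℕ)) := by
              rw [show n + 1 - (k : ℕ) = n - k + 1 by omega, pow_succ]; ring
          _ ≤ (C * ((‖l‖ + 2) * (n + 1)) * K) * (L ^ (n - (k : ℕ)) * L ^ (k : ℕ)) := by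
              gcongr
          _ = _ := by rw [← pow_add, Nat.sub_add_cancel hk]
      rw [Finset.sum_const, Finset.card_univ, Fintype.card_fin, nsmul_eq_mul] at h3
      rw [div_le_iff₀ (by rw [h2]; exact mul_pos hn (hn.trans_le h1)), h2]
      refine h3.trans ?_
      calc ((n + 1 : ℕ) : ℝ) * (C * ((‖l‖ + 2) * (n + 1)) * K * L ^ n)
          = (C * (‖l‖ + 2) * K) * L ^ n * ((n + 1) * (n + 1)) := by push_cast; ring
        _ ≤ L * L ^ n * ((n + 1) * ‖(n : ℂ) + 1 + μ‖) := by
            gcongr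
            rw [hL]; linarith
        _ = _ := by rw [pow_succ]; ring

/-- Frobenius: a holomorphic solution `h`, `h 0 = 1`, of the equation satisfied by `t ^ (-l) y`. -/
theorem exists_frobenius {A B : ℂ → ℂ} (hA : AnalyticAt ℂ A 0) (hB : AnalyticAt ℂ B 0) {l μ : ℂ}
    (hl : l ^ 2 + A 0 * l + B 0 = 0) (hμ : μ = 2 * l + A 0) (hre : 0 ≤ μ.re) :
    ∃ h : ℂ → ℂ, AnalyticAt ℂ h 0 ∧ h 0 = 1 ∧ ∀ᶠ t in 𝓝 (0 : ℂ),
      t * deriv (fun t => t * deriv h t) t + (2 * l + A t) * (t * deriv h t)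
        + (l ^ 2 + A t * l + B t) * h t = 0 := by
  obtain ⟨a, ha⟩ := hA.exists_hasTaylor
  obtain ⟨b, hb⟩ := hB.exists_hasTaylor
  obtain ⟨C₁, K₁, hC₁, hK₁, h₁⟩ := ha.exists_norm_le
  obtain ⟨C₂, K₂, hC₂, hK₂, h₂⟩ := hb.exists_norm_le
  have hC : 0 < max C₁ C₂ := lt_max_of_lt_left hC₁
  have hK : 0 < max K₁ K₂ := lt_max_of_lt_left hK₁
  have hgrow := norm_frobeniusCoeff_le (a := a) (b := b) (l := l) hre hC hK
    (fun n => (h₁ n).trans (by gcongr <;> exact le_max_left _ _))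
    (fun n => (h₂ n).trans (by gcongr <;> exact le_max_right _ _))
  obtain ⟨h, hh⟩ := exists_hasTaylor_of_norm_le (c := frobeniusCoeff a b l μ) (C := 1)
    (K := max K₁ K₂ + max C₁ C₂ * (‖l‖ + 2) * max K₁ K₂) (by positivity)
    (fun n => by rw [one_mul]; exact hgrow n)
  refine ⟨h, hh.analyticAt, by rw [hh.apply_zero, frobeniusCoeff], ?_⟩
  set c := frobeniusCoeff a b l μ with hc
  have T := ((hh.euler.euler.add (hh.euler.const_mul (2 * l))).add
    (hh.const_mul (l ^ 2))).add ((ha.mul (hh.euler.add (hh.const_mul l))).add (hb.mul hh))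
  have hzero : (fun n : ℕ => (n : ℂ) * (n * c n) + 2 * l * (n * c n) + l ^ 2 * c n +
      (∑ k ∈ Finset.HasAntidiagonal.antidiagonal n, a k.1 * ((k.2 : ℂ) * c k.2 + l * c k.2) +
        ∑ k ∈ Finset.HasAntidiagonal.antidiagonal n, b k.1 * c k.2)) =
      fun n => if n = 0 then 0 else 0 := by
    ext n
    rw [ite_self, ← Finset.sum_add_distrib, ← Finset.Nat.sum_antidiagonal_swap,
      Finset.Nat.sum_antidiagonal_eq_sum_range_succ_mk, Finset.sum_range_succ]
    rcases n with _ | n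
    · rw [ha.apply_zero, hb.apply_zero] at hl
      simp [hc, frobeniusCoeff]
      linear_combination hl
    · have e1 := ha.apply_zero
      have e2 := hb.apply_zero
      have e3 : c (n + 1) * ((n + 1) * (n + 1 + μ)) =
          -∑ k ∈ Finset.range (n + 1), (a (n + 1 - k) * (l + k) + b (n + 1 - k)) * c k := by
        rw [hc, frobeniusCoeff, div_mul_cancel₀, ← hc]
        · rw [Finset.sum_range]
        · refine mul_ne_zero (by exact_mod_cast n.succ_ne_zero) fun h0 => ?_
          have := congrArg Complex.re h0
          simp at this
          have : (0 : ℝ) ≤ n := Nat.cast_nonneg n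
          linarith
      have e4 : ∑ k ∈ Finset.range (n + 1), (a (n + 1 - k) * (l + k) + b (n + 1 - k)) * c k =
          ∑ k ∈ Finset.range (n + 1), (a (n + 1 - k) * (k * c k + l * c k) +
            b (n + 1 - k) * c k) := Finset.sum_congr rfl fun k _ => by ring
      rw [e4] at e3
      simp only [Prod.swap_prod_mk, Nat.sub_self]
      rw [e1, e2] at hl
      rw [e1] at hμ
      push_cast
      rw [hμ] at e3
      linear_combination e3 + c (n + 1) * hl
  rw [hzero] at T
  filter_upwards [T.eventuallyEq (hasTaylor_pow 0 0)] with t ht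
  linear_combination ht

/-! ### A Fuchsian equation in the logarithmic coordinate -/

/-- `F` is a holomorphic solution of `F'' + A(exp s) F' + B(exp s) F = 0` on the half plane
`re s < R`. With `t = exp s` this is a second order equation with a Fuchsian point at `t = 0`. -/
def IsLogSolution (A B : ℂ → ℂ) (R : ℝ) (F : ℂ → ℂ) : Prop :=
  ∀ s : ℂ, s.re < R → AnalyticAt ℂ F s ∧
    deriv (deriv F) s + A (exp s) * deriv F s + B (exp s) * F s = 0

theorem halfPlane_mem_nhds {R : ℝ} {s : ℂ} (hs : s.re < R) : {s : ℂ | s.re < R} ∈ 𝓝 s :=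
  (isOpen_lt continuous_re continuous_const).mem_nhds hs

/-- A property that holds near `t = 0` holds for `t = exp s` in a half plane. -/
theorem exists_forall_exp_of_eventually {P : ℂ → Prop} (h : ∀ᶠ t in 𝓝 (0 : ℂ), P t) :
    ∃ R : ℝ, ∀ s : ℂ, s.re < R → P (exp s) := by
  obtain ⟨ε, hε, h⟩ := Metric.eventually_nhds_iff.1 h
  refine ⟨Real.log ε, fun s hs => h ?_⟩
  rw [dist_zero_right, norm_exp]
  exact (Real.lt_log_iff_exp_lt hε).1 hs

theorem hasDerivAt_exp_mul_comp_exp {g : ℂ → ℂ} {s : ℂ} (l : ℂ) (hg : AnalyticAt ℂ g (exp s)) :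
    HasDerivAt (fun s => exp (l * s) * g (exp s))
      (exp (l * s) * (l * g (exp s) + exp s * deriv g (exp s))) s := by
  have h1 : HasDerivAt (fun s => exp (l * s)) (exp (l * s) * l) s := by
    simpa using ((hasDerivAt_id s).const_mul l).cexp
  have h2 := hg.differentiableAt.hasDerivAt.comp s (Complex.hasDerivAt_exp s)
  exact (h1.mul h2).congr_deriv (by simp only [Function.comp_apply]; ring)

/-- The first solution `t ^ l h(t)` of Frobenius' pair, in the coordinate `s = log t`. -/
noncomputable def frobeniusFst (l : ℂ) (h : ℂ → ℂ) (s : ℂ) : ℂ := exp (l * s) * h (exp s)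

/-- The second solution `t ^ (l - μ) H(t) + c log t · t ^ l h(t)` of Frobenius' pair, in the
coordinate `s = log t`. -/
noncomputable def frobeniusSnd (l μ c : ℂ) (h H : ℂ → ℂ) (s : ℂ) : ℂ :=
  exp ((l - μ) * s) * H (exp s) + c * s * frobeniusFst l h s

/-- Frobenius' fundamental pair of solutions at a Fuchsian point, with exponents `l` and `l - μ`.
The logarithmic term, with coefficient `c`, occurs only if `μ` is a natural number. -/
structure IsFrobeniusPair (A B : ℂ → ℂ) (l μ c : ℂ) (R : ℝ) (h H : ℂ → ℂ) : Prop where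
  analytic_fst : AnalyticAt ℂ h 0
  analytic_snd : AnalyticAt ℂ H 0
  fst_zero : h 0 = 1
  snd_zero : μ ≠ 0 → H 0 ≠ 0
  log_of_eq_zero : μ = 0 → c ≠ 0
  resonant : c ≠ 0 → ∃ m : ℕ, μ = m
  solution_fst : IsLogSolution A B R (frobeniusFst l h)
  solution_snd : IsLogSolution A B R (frobeniusSnd l μ c h H)
  wronskian : ∀ s : ℂ, s.re < R → frobeniusFst l h s * deriv (frobeniusSnd l μ c h H) s
    - deriv (frobeniusFst l h) s * frobeniusSnd l μ c h H s ≠ 0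

/-- The second solution is found by reduction of order: it is the product of the first one with a
primitive `v` of `exp (-μ s) k(exp s)`, where `k` is holomorphic and does not vanish. -/
theorem exists_isFrobeniusPair {A B : ℂ → ℂ} (hA : AnalyticAt ℂ A 0) (hB : AnalyticAt ℂ B 0)
    {l μ : ℂ} (hl : l ^ 2 + A 0 * l + B 0 = 0) (hμ : μ = 2 * l + A 0) (hre : 0 ≤ μ.re) :
    ∃ c R h H, IsFrobeniusPair A B l μ c R h H := by
  obtain ⟨h, hh, h0, hode⟩ := exists_frobenius hA hB hl hμ hre
  obtain ⟨α, c₀, m₀, hα, -, hc₀, hαe⟩ := exists_euler_sub_eq (g := fun t => A t - A 0)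
    (hA.sub analyticAt_const) 0
  have hc₀ : c₀ = 0 := by simpa using hc₀ rfl
  have hne : h 0 ≠ 0 := by rw [h0]; exact one_ne_zero
  -- up to a power of `t`, `exp (-α)` is the Wronskian, and `k` is its quotient by the square of
  -- the first solution
  have hk : AnalyticAt ℂ (fun t => exp (-α t) * (h t ^ 2)⁻¹) 0 :=
    hα.neg.cexp.mul ((hh.pow 2).inv (pow_ne_zero 2 hne))
  set k : ℂ → ℂ := fun t => exp (-α t) * (h t ^ 2)⁻¹ with hkdef
  obtain ⟨G, c, m, hG, hcm, hc, hGe⟩ := exists_euler_sub_eq hk μ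
  have hk0 : k 0 ≠ 0 := mul_ne_zero (exp_ne_zero _) (inv_ne_zero (pow_ne_zero 2 hne))
  obtain ⟨R, hR⟩ := exists_forall_exp_of_eventually
    (hode.and (hαe.and (hGe.and (hh.eventually_analyticAt.and (hα.eventually_analyticAt.and
      (hG.eventually_analyticAt.and (hk.eventually_analyticAt.and
        (hh.continuousAt.eventually_ne hne))))))))
  -- the first solution and its derivatives
  have d0 : ∀ s : ℂ, s.re < R → HasDerivAt (frobeniusFst l h)
      (exp (l * s) * (l * h (exp s) + exp s * deriv h (exp s))) s := fun s hs =>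
    hasDerivAt_exp_mul_comp_exp l (hR s hs).2.2.2.1
  have dd0 : ∀ s : ℂ, s.re < R → HasDerivAt (deriv (frobeniusFst l h))
      (exp (l * s) * (l * (l * h (exp s) + exp s * deriv h (exp s)) + (l * (exp s *
        deriv h (exp s)) + exp s * deriv (fun t => t * deriv h t) (exp s)))) s := by
    intro s hs
    have ha := (hR s hs).2.2.2.1
    have hb : AnalyticAt ℂ (fun t => t * deriv h t) (exp s) := analyticAt_id.mul ha.deriv
    have e : (fun s => exp (l * s) * (l * h (exp s) + exp s * deriv h (exp s)))
        =ᶠ[𝓝 s] deriv (frobeniusFst l h) := by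
      filter_upwards [halfPlane_mem_nhds hs] with u hu using (d0 u hu).deriv.symm
    have := hasDerivAt_exp_mul_comp_exp (s := s) (g := fun t => l * h t + t * deriv h t) l
      ((analyticAt_const.mul ha).add hb)
    refine HasDerivAt.congr_of_eventuallyEq (this.congr_deriv ?_) e.symm
    rw [((ha.differentiableAt.hasDerivAt.const_mul l).fun_add
      hb.differentiableAt.hasDerivAt).deriv]
    ring
  have a0 : ∀ s : ℂ, s.re < R → AnalyticAt ℂ (frobeniusFst l h) s := by
    intro s hs
    rw [Complex.analyticAt_iff_eventually_differentiableAt]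
    filter_upwards [halfPlane_mem_nhds hs] with u hu using (d0 u hu).differentiableAt
  have sol0 : IsLogSolution A B R (frobeniusFst l h) := by
    intro s hs
    refine ⟨a0 s hs, ?_⟩
    rw [(dd0 s hs).deriv, (d0 s hs).deriv, frobeniusFst]
    linear_combination exp (l * s) * (hR s hs).1
  -- the factor `v`
  set v : ℂ → ℂ := fun s => exp (-μ * s) * G (exp s) + c * s with hv
  have dv : ∀ s : ℂ, s.re < R → HasDerivAt v (exp (-μ * s) * k (exp s)) s := by
    intro s hs
    have := (hasDerivAt_exp_mul_comp_exp (s := s) (-μ) (hR s hs).2.2.2.2.2.1).add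
      ((hasDerivAt_id s).const_mul c)
    refine this.congr_deriv ?_
    have e1 := (hR s hs).2.2.1
    -- the resonant monomial is cancelled by the exponential: it integrates to the logarithm
    have e2 : c * (exp (-μ * s) * exp s ^ m) = c := by
      by_cases h : c = 0
      · simp [h]
      · rw [hcm h, ← Complex.exp_nat_mul, ← Complex.exp_add]
        simp
    linear_combination exp (-μ * s) * e1 - e2
  have ddv : ∀ s : ℂ, s.re < R → HasDerivAt (deriv v)
      (exp (-μ * s) * (-μ * k (exp s) + exp s * deriv k (exp s))) s := by
    intro s hs
    refine (hasDerivAt_exp_mul_comp_exp (s := s) (-μ)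
      (hR s hs).2.2.2.2.2.2.1).congr_of_eventuallyEq ?_
    filter_upwards [halfPlane_mem_nhds hs] with u hu using (dv u hu).deriv
  have hSnd : frobeniusSnd l μ c h (fun t => h t * G t) = fun s => frobeniusFst l h s * v s := by
    ext s
    simp only [frobeniusSnd, frobeniusFst, hv]
    rw [sub_mul, sub_eq_add_neg, Complex.exp_add, ← neg_mul]
    ring
  have d1 : ∀ s : ℂ, s.re < R → HasDerivAt (frobeniusSnd l μ c h (fun t => h t * G t))
      (deriv (frobeniusFst l h) s * v s + frobeniusFst l h s * deriv v s) s := by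
    intro s hs
    rw [hSnd]
    exact (a0 s hs).differentiableAt.hasDerivAt.mul (dv s hs).differentiableAt.hasDerivAt
  have a1 : ∀ s : ℂ, s.re < R → AnalyticAt ℂ (frobeniusSnd l μ c h (fun t => h t * G t)) s := by
    intro s hs
    rw [Complex.analyticAt_iff_eventually_differentiableAt]
    filter_upwards [halfPlane_mem_nhds hs] with u hu using (d1 u hu).differentiableAt
  have dd1 : ∀ s : ℂ, s.re < R → HasDerivAt (deriv (frobeniusSnd l μ c h (fun t => h t * G t)))
      ((deriv (deriv (frobeniusFst l h)) s * v s + deriv (frobeniusFst l h) s * deriv v s) +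
        (deriv (frobeniusFst l h) s * deriv v s + frobeniusFst l h s * deriv (deriv v) s)) s := by
    intro s hs
    refine HasDerivAt.congr_of_eventuallyEq
      (((a0 s hs).deriv.differentiableAt.hasDerivAt.mul (dv s hs).differentiableAt.hasDerivAt).add
      ((a0 s hs).differentiableAt.hasDerivAt.mul (ddv s hs).differentiableAt.hasDerivAt)) ?_
    filter_upwards [halfPlane_mem_nhds hs] with u hu using (d1 u hu).deriv
  refine ⟨c, R, h, fun t => h t * G t, hh, hh.mul hG, h0, fun hμ0 h1 => ?_, fun h1 => ?_,
    fun h1 => ⟨m, hcm h1⟩, sol0, fun s hs => ⟨a1 s hs, ?_⟩, fun s hs => ?_⟩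
  · have hG0 : G 0 = 0 := (mul_eq_zero.1 h1).resolve_left hne
    have e1 := hGe.self_of_nhds
    rw [hG0] at e1
    have e2 : c * (0 : ℂ) ^ m = 0 := by
      by_cases h : c = 0
      · simp [h]
      · have : m ≠ 0 := fun h2 => hμ0 (by rw [hcm h, h2, Nat.cast_zero])
        simp [this]
    exact hk0 (by linear_combination -e1 + e2)
  · rw [hc h1]; exact hk0
  · have e0 := (sol0 s hs).2
    rw [(dd1 s hs).deriv, (d1 s hs).deriv, hSnd, (ddv s hs).deriv, (dv s hs).deriv,
      (d0 s hs).deriv]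
    rw [(d0 s hs).deriv] at e0
    obtain ⟨-, e1, -, ha, hαa, -, hka, hn⟩ := hR s hs
    have dk : HasDerivAt k (exp (-α (exp s)) * -deriv α (exp s) * (h (exp s) ^ 2)⁻¹ +
        exp (-α (exp s)) * (-((2 : ℕ) * h (exp s) ^ (2 - 1) * deriv h (exp s)) /
          (h (exp s) ^ 2) ^ 2)) (exp s) :=
      (hαa.differentiableAt.hasDerivAt.fun_neg.cexp).mul
        ((ha.differentiableAt.hasDerivAt.fun_pow 2).fun_inv (pow_ne_zero 2 hn))
    rw [hc₀] at e1
    have e2 : h (exp s) * (exp s * deriv k (exp s)) = -k (exp s) *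
        (2 * (exp s * deriv h (exp s)) + (A (exp s) - A 0) * h (exp s)) := by
      rw [dk.deriv]
      simp only [hkdef]
      field_simp
      linear_combination (-h (exp s) ^ 2) * e1
    simp only [frobeniusFst] at e0 ⊢
    linear_combination v s * e0 + exp (l * s) * exp (-μ * s) * e2
      - exp (l * s) * exp (-μ * s) * k (exp s) * h (exp s) * hμ
  · rw [(d1 s hs).deriv, hSnd, (dv s hs).deriv]
    have hn : h (exp s) ≠ 0 := (hR s hs).2.2.2.2.2.2.2
    have : frobeniusFst l h s * (frobeniusFst l h s * (exp (-μ * s) * k (exp s))) ≠ 0 := by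
      simp only [frobeniusFst, hkdef]
      simp [hn, exp_ne_zero]
    convert this using 1
    ring

/-! ### The Levelt valuation -/

theorem LeveltGE.congr {F G : ℂ → ℂ} {k : ℤ} (hF : LeveltGE F k) {R : ℝ}
    (h : ∀ s : ℂ, s.re < R → F s = G s) : LeveltGE G k := by
  intro l hl c d hcd
  refine (hF l hl c d hcd).congr' ?_
  have : ∀ᶠ s : ℂ in comap Complex.re atBot, s.re < R := tendsto_comap.eventually_lt_atBot R
  filter_upwards [this.filter_mono inf_le_left] with s hs
  rw [h s hs]

theorem LeveltGE.add {F G : ℂ → ℂ} {k : ℤ} (hF : LeveltGE F k) (hG : LeveltGE G k) :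
    LeveltGE (fun s => F s + G s) k := by
  intro l hl c d hcd
  simpa only [add_mul, add_zero] using (hF l hl c d hcd).add (hG l hl c d hcd)

theorem LeveltGE.const_mul {F : ℂ → ℂ} {k : ℤ} (a : ℂ) (hF : LeveltGE F k) :
    LeveltGE (fun s => a * F s) k := by
  intro l hl c d hcd
  simpa only [mul_assoc, mul_zero] using (hF l hl c d hcd).const_mul a

theorem LeveltGE.of_const_mul {F : ℂ → ℂ} {k : ℤ} {a : ℂ} (ha : a ≠ 0)
    (hF : LeveltGE (fun s => a * F s) k) : LeveltGE F k := by
  simpa only [← mul_assoc, inv_mul_cancel₀ ha, one_mul] using hF.const_mul a⁻¹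

theorem tendsto_abs_add_mul_exp_atBot {a : ℝ} (ha : 0 < a) (M C : ℝ) :
    Tendsto (fun x : ℝ => (|x| + M) * (Real.exp (a * x) * C)) atBot (𝓝 0) := by
  have h1 : Tendsto (fun x : ℝ => x * Real.exp (-a * x)) atTop (𝓝 0) := by
    have := Real.tendsto_pow_mul_exp_neg_atTop_nhds_zero 1
    have h2 := (this.comp (tendsto_id.const_mul_atTop ha)).const_mul a⁻¹
    rw [mul_zero] at h2
    refine h2.congr fun x => ?_
    simp only [Function.comp_apply, id, pow_one]
    field_simp
  have h0 : Tendsto (fun x : ℝ => Real.exp (-a * x)) atTop (𝓝 0) :=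
    Real.tendsto_exp_atBot.comp (tendsto_id.const_mul_atTop_of_neg (neg_lt_zero.2 ha))
  have h2 := ((h1.add (h0.const_mul M)).mul_const C).comp tendsto_neg_atBot_atTop
  simp only [mul_zero, add_zero, zero_mul] at h2
  refine h2.congr' ?_
  filter_upwards [eventually_le_atBot 0] with x hx
  simp only [Function.comp_apply]
  rw [abs_of_nonpos hx]
  ring_nf

/-- An exponential that decays as `re s → -∞` beats a polynomial of degree one on a horizontal
strip. -/
theorem tendsto_mul_exp_strip {ν : ℂ} (hν : 0 < ν.re) (a b : ℂ) (c d : ℝ) :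
    Tendsto (fun s : ℂ => (a + b * s) * exp (ν * s))
      (comap Complex.re atBot ⊓ 𝓟 {s : ℂ | c < s.im ∧ s.im < d}) (𝓝 0) := by
  set M := max |c| |d|
  have hlim : Tendsto (fun s : ℂ => (‖b‖ * ((|s.re| + M) *
        (Real.exp (ν.re * s.re) * Real.exp (|ν.im| * M)))) +
        ‖a‖ * ((|s.re| + 1) * (Real.exp (ν.re * s.re) * Real.exp (|ν.im| * M))))
      (comap Complex.re atBot ⊓ 𝓟 {s : ℂ | c < s.im ∧ s.im < d}) (𝓝 0) := by
    have h := ((tendsto_abs_add_mul_exp_atBot hν M (Real.exp (|ν.im| * M))).const_mul ‖b‖).add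
      ((tendsto_abs_add_mul_exp_atBot hν 1 (Real.exp (|ν.im| * M))).const_mul ‖a‖)
    simp only [mul_zero, add_zero] at h
    exact h.comp (tendsto_comap.mono_left inf_le_left)
  refine squeeze_zero_norm' ?_ hlim
  have : ∀ᶠ s : ℂ in comap Complex.re atBot ⊓ 𝓟 {s : ℂ | c < s.im ∧ s.im < d},
    c < s.im ∧ s.im < d := (eventually_principal.2 fun s hs => hs).filter_mono inf_le_right
  filter_upwards [this] with s hs
  have him : |s.im| ≤ M := abs_le_max_abs_abs hs.1.le hs.2.le
  have hexp : ‖exp (ν * s)‖ ≤ Real.exp (ν.re * s.re) * Real.exp (|ν.im| * M) := by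
    rw [norm_exp, ← Real.exp_add, Real.exp_le_exp, Complex.mul_re]
    have h1 : -(ν.im * s.im) ≤ |ν.im| * M := by
      refine (neg_le_abs _).trans ?_
      rw [abs_mul]
      gcongr
    linarith
  have hs' : ‖s‖ ≤ |s.re| + M := (norm_le_abs_re_add_abs_im s).trans (by linarith)
  calc ‖(a + b * s) * exp (ν * s)‖ ≤ (‖a‖ * (|s.re| + 1) + ‖b‖ * (|s.re| + M)) *
        (Real.exp (ν.re * s.re) * Real.exp (|ν.im| * M)) := by
        rw [norm_mul]
        gcongr
        refine (norm_add_le _ _).trans ?_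
        rw [norm_mul]
        gcongr
        have := mul_nonneg (norm_nonneg a) (abs_nonneg s.re)
        linarith
    _ = _ := by ring

theorem leveltGE_mul_exp_mul {h : ℂ → ℂ} (hh : AnalyticAt ℂ h 0) {l : ℂ} {k : ℤ}
    (hk : (k : ℝ) ≤ l.re) (a b : ℂ) :
    LeveltGE (fun s => (a + b * s) * (exp (l * s) * h (exp s))) k := by
  intro x hx c d _
  have h1 : 0 < (l - x).re := by simpa using hx.trans_le hk
  have h2 : Tendsto (fun s => h (exp s))
      (comap Complex.re atBot ⊓ 𝓟 {s : ℂ | c < s.im ∧ s.im < d}) (𝓝 (h 0)) :=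
    hh.continuousAt.tendsto.comp
      (tendsto_exp_comap_re_atBot.mono_left inf_le_left)
  have h3 := (tendsto_mul_exp_strip h1 a b c d).mul h2
  rw [zero_mul] at h3
  refine h3.congr fun s => ?_
  rw [sub_mul, sub_eq_add_neg, ← neg_mul, Complex.exp_add]
  ring

/-- A lower bound for the valuation gives decay along the negative real axis. -/
theorem LeveltGE.tendsto_mul_exp {F : ℂ → ℂ} {k : ℤ} (hF : LeveltGE F k) {l : ℂ}
    (hl : l.re < k) : Tendsto (fun x : ℝ => F x * exp (-l * x)) atBot (𝓝 0) := by
  obtain ⟨y, hy1, hy2⟩ := exists_between hl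
  have h1 := hF y hy2 (-1) 1 (by linarith [Real.pi_gt_three])
  have h2 : Tendsto (fun x : ℝ => (x : ℂ))
      atBot (comap Complex.re atBot ⊓ 𝓟 {s : ℂ | -1 < s.im ∧ s.im < 1}) := by
    refine tendsto_inf.2 ⟨tendsto_comap_iff.2 ?_, tendsto_principal.2 ?_⟩
    · exact tendsto_id.congr fun x => by simp
    · exact Eventually.of_forall fun x => by simp
  have h3 : Tendsto (fun x : ℝ => exp ((y - l) * x)) atBot (𝓝 0) := by
    rw [tendsto_zero_iff_norm_tendsto_zero]
    have : Tendsto (fun x : ℝ => (y - l.re) * x) atBot atBot :=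
      tendsto_id.const_mul_atBot (sub_pos.2 hy1)
    refine (Real.tendsto_exp_atBot.comp this).congr fun x => ?_
    simp [norm_exp]
  have h4 := (h1.comp h2).mul h3
  rw [zero_mul] at h4
  refine h4.congr fun x => ?_
  simp only [Function.comp_apply]
  rw [mul_assoc, ← Complex.exp_add]
  ring_nf

namespace IsFrobeniusPair

variable {A B : ℂ → ℂ} {l μ c : ℂ} {R : ℝ} {h H : ℂ → ℂ}

theorem le_floor_of_leveltGE_fst (P : IsFrobeniusPair A B l μ c R h H) {k : ℤ}
    (hk : LeveltGE (frobeniusFst l h) k) : k ≤ ⌊l.re⌋ := by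
  rw [Int.le_floor]
  by_contra! hlt
  have h1 := hk.tendsto_mul_exp hlt
  have hx : Tendsto (fun x : ℝ => h (exp x)) atBot (𝓝 1) := by
    rw [← P.fst_zero]
    refine P.analytic_fst.continuousAt.tendsto.comp ?_
    rw [tendsto_zero_iff_norm_tendsto_zero]
    exact Real.tendsto_exp_atBot.congr fun x => by simp [norm_exp]
  refine one_ne_zero (tendsto_nhds_unique (hx.congr fun x => ?_) h1)
  rw [frobeniusFst, mul_right_comm, ← Complex.exp_add]
  simp

/-- No combination that involves the second solution vanishes faster than `t ^ (l - μ)`. -/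
theorem le_floor_of_leveltGE_snd (P : IsFrobeniusPair A B l μ c R h H) (hre : 0 ≤ μ.re)
    {a b : ℂ} (hb : b ≠ 0) {k : ℤ}
    (hk : LeveltGE (fun s => a * frobeniusFst l h s + b * frobeniusSnd l μ c h H s) k) :
    k ≤ ⌊(l - μ).re⌋ := by
  rw [Int.le_floor]
  by_contra! hlt
  have hexp : Tendsto (fun x : ℝ => exp (x : ℂ)) atBot (𝓝 0) := by
    rw [tendsto_zero_iff_norm_tendsto_zero]
    exact Real.tendsto_exp_atBot.congr fun x => by simp [norm_exp]
  have hx : Tendsto (fun x : ℝ => h (exp x)) atBot (𝓝 1) := by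
    rw [← P.fst_zero]
    exact P.analytic_fst.continuousAt.tendsto.comp hexp
  have Hx : Tendsto (fun x : ℝ => H (exp x)) atBot (𝓝 (H 0)) :=
    P.analytic_snd.continuousAt.tendsto.comp hexp
  -- after division by `t ^ (l - μ)`
  have key : Tendsto (fun x : ℝ => (a + b * c * x) * exp (μ * x) * h (exp x) + b * H (exp x))
      atBot (𝓝 0) := by
    refine (hk.tendsto_mul_exp hlt).congr fun x => ?_
    simp only [frobeniusFst, frobeniusSnd]
    have e1 : exp (l * x) * exp (-(l - μ) * x) = exp (μ * x) := by
      rw [← Complex.exp_add]; ring_nf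
    have e2 : exp ((l - μ) * x) * exp (-(l - μ) * x) = 1 := by
      rw [← Complex.exp_add, ← add_mul]; simp
    linear_combination (a * h (exp x) + b * c * x * h (exp x)) * e1 + b * H (exp x) * e2
  by_cases hμ : μ = 0
  · -- the logarithm is unbounded
    have hc := P.log_of_eq_zero hμ
    have hinv : Tendsto (fun x : ℝ => ((x : ℂ))⁻¹) atBot (𝓝 0) := by
      rw [tendsto_zero_iff_norm_tendsto_zero]
      simpa [Function.comp_def] using (tendsto_inv_atTop_zero (𝕜 := ℝ)).comp tendsto_abs_atBot_atTop
    have h1 := ((key.mul hinv).sub (((hx.const_mul a).add (Hx.const_mul b)).mul hinv))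
    simp only [mul_zero, sub_zero] at h1
    have h2 : Tendsto (fun x : ℝ => b * c * h (exp x)) atBot (𝓝 0) := by
      refine h1.congr' ?_
      filter_upwards [eventually_lt_atBot 0] with x hx0
      have : (x : ℂ) ≠ 0 := by exact_mod_cast hx0.ne
      rw [hμ]
      field_simp
      simp
      ring
    have h3 := tendsto_nhds_unique h2 (hx.const_mul (b * c))
    rw [mul_one] at h3
    exact mul_ne_zero hb hc h3.symm
  have hH := P.snd_zero hμ
  rcases hre.eq_or_lt with h0 | hpos
  · -- `exp (μ x)` is purely oscillating: it changes sign under `x ↦ x + π / im μ`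
    have hc : c = 0 := by
      by_contra hc
      obtain ⟨m, hm⟩ := P.resonant hc
      refine hμ ?_
      rw [hm] at h0 ⊢
      exact_mod_cast h0.symm
    have him : μ.im ≠ 0 := fun h => hμ (Complex.ext h0.symm h)
    set y : ℝ := Real.pi / μ.im with hy
    have hshift : Tendsto (fun x : ℝ => x + y) atBot atBot :=
      tendsto_atBot_add_const_right _ y tendsto_id
    have e1 : exp (μ * y) = -1 := by
      have : μ * y = Real.pi * I := by
        apply Complex.ext
        · simp [← h0]
        · simp [← h0, hy]
          field_simp
      rw [this, exp_pi_mul_I]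
    have h1 := key.add (key.comp hshift)
    have h2 : Tendsto (fun x : ℝ => a * (exp (μ * x) * (h (exp x) - h (exp ((x + y : ℝ) : ℂ)))))
        atBot (𝓝 0) := by
      rw [← mul_zero a]
      refine Tendsto.const_mul a ?_
      have h3 := hx.sub (hx.comp hshift)
      rw [sub_self] at h3
      refine squeeze_zero_norm (fun x => ?_) (tendsto_zero_iff_norm_tendsto_zero.1 h3)
      rw [norm_mul, norm_exp]
      simp [← h0]
    have h3 := h1.sub h2
    have h4 := (Hx.const_mul b).add ((Hx.comp hshift).const_mul b)
    simp only [add_zero, sub_zero] at h3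
    have h5 := tendsto_nhds_unique (h3.congr fun x => ?_) h4
    · exact mul_ne_zero hb hH (by linear_combination -h5 / 2)
    · simp only [Function.comp_apply, hc]
      have e2 : exp (μ * ((x + y : ℝ) : ℂ)) = -exp (μ * x) := by
        rw [ofReal_add, mul_add, Complex.exp_add, e1]; ring
      rw [e2]
      ring
  · have h2 : Tendsto (fun x : ℝ => (a + b * c * x) * exp (μ * x)) atBot (𝓝 0) := by
      refine (tendsto_mul_exp_strip hpos a (b * c) (-1) 1).comp
        (f := fun x : ℝ => (x : ℂ)) ?_
      refine tendsto_inf.2 ⟨tendsto_comap_iff.2 ?_, tendsto_principal.2 ?_⟩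
      · exact tendsto_id.congr fun x => by simp
      · exact Eventually.of_forall fun x => by simp
    have h3 := (h2.mul hx).add (Hx.const_mul b)
    rw [zero_mul, zero_add] at h3
    exact mul_ne_zero hb hH (tendsto_nhds_unique h3 key)

theorem leveltGE_fst (P : IsFrobeniusPair A B l μ c R h H) :
    LeveltGE (frobeniusFst l h) ⌊l.re⌋ := by
  have := leveltGE_mul_exp_mul P.analytic_fst (Int.floor_le l.re) 1 0
  simp only [zero_mul, add_zero, one_mul] at this
  exact this

theorem leveltGE_snd (P : IsFrobeniusPair A B l μ c R h H) (hre : 0 ≤ μ.re) :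
    LeveltGE (frobeniusSnd l μ c h H) ⌊(l - μ).re⌋ := by
  have h1 := leveltGE_mul_exp_mul P.analytic_snd (Int.floor_le (l - μ).re) 1 0
  have h2 := leveltGE_mul_exp_mul P.analytic_fst (l := l) (k := ⌊(l - μ).re⌋)
    ((Int.floor_le _).trans (by simpa using hre)) 0 c
  have := h1.add h2
  simp only [zero_mul, add_zero, one_mul, zero_add] at this
  exact this

theorem mono (P : IsFrobeniusPair A B l μ c R h H) {R' : ℝ} (hR : R' ≤ R) :
    IsFrobeniusPair A B l μ c R' h H :=
  { P with
    solution_fst := fun s hs => P.solution_fst s (hs.trans_le hR)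
    solution_snd := fun s hs => P.solution_snd s (hs.trans_le hR)
    wronskian := fun s hs => P.wronskian s (hs.trans_le hR) }

theorem fst_add_two_pi_I (l : ℂ) (h : ℂ → ℂ) (s : ℂ) :
    frobeniusFst l h (s + 2 * Real.pi * I) = exp (2 * Real.pi * I * l) * frobeniusFst l h s := by
  rw [frobeniusFst, frobeniusFst, Complex.exp_add s, exp_two_pi_mul_I, mul_one, mul_add,
    Complex.exp_add, mul_comm l (2 * Real.pi * I)]
  ring

/-- If there is a logarithm then `μ` is an integer, and both diagonal entries of the monodromy
matrix agree. -/
theorem snd_add_two_pi_I (P : IsFrobeniusPair A B l μ c R h H) (s : ℂ) :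
    frobeniusSnd l μ c h H (s + 2 * Real.pi * I) =
      frobeniusFst l h s * (2 * Real.pi * I * c * exp (2 * Real.pi * I * l)) +
      frobeniusSnd l μ c h H s * exp (2 * Real.pi * I * (l - μ)) := by
  have h1 := fst_add_two_pi_I (l - μ) H s
  simp only [frobeniusFst] at h1
  have e1 : c * exp (2 * Real.pi * I * (l - μ)) = c * exp (2 * Real.pi * I * l) := by
    by_cases hc : c = 0
    · simp [hc]
    obtain ⟨m, rfl⟩ := P.resonant hc
    have : 2 * Real.pi * I * (l - m) = 2 * Real.pi * I * l - m * (2 * Real.pi * I) := by ring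
    rw [this, Complex.exp_sub, exp_nat_mul_two_pi_mul_I, div_one]
  rw [frobeniusSnd, frobeniusSnd, h1, fst_add_two_pi_I]
  linear_combination (-s * frobeniusFst l h s) * e1

end IsFrobeniusPair

/-! ### The solution space is two-dimensional -/

theorem IsLogSolution.hasDerivAt_wronskian {A B F G : ℂ → ℂ} {R : ℝ} (hF : IsLogSolution A B R F)
    (hG : IsLogSolution A B R G) {s : ℂ} (hs : s.re < R) :
    HasDerivAt (fun s => F s * deriv G s - deriv F s * G s)
      (-A (exp s) * (F s * deriv G s - deriv F s * G s)) s := by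
  have f1 := (hF s hs).1.differentiableAt.hasDerivAt
  have f2 := (hF s hs).1.deriv.differentiableAt.hasDerivAt
  have g1 := (hG s hs).1.differentiableAt.hasDerivAt
  have g2 := (hG s hs).1.deriv.differentiableAt.hasDerivAt
  refine ((f1.mul g2).sub (f2.mul g1)).congr_deriv ?_
  linear_combination F s * (hG s hs).2 - G s * (hF s hs).2

/-- Two Wronskians satisfy the same first order equation, hence are proportional. -/
theorem IsLogSolution.exists_wronskian_eq_mul {A B F G f g : ℂ → ℂ} {R : ℝ}
    (hF : IsLogSolution A B R F) (hG : IsLogSolution A B R G)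
    (hf : IsLogSolution A B R f) (hg : IsLogSolution A B R g)
    (hne : ∀ s : ℂ, s.re < R → f s * deriv g s - deriv f s * g s ≠ 0) :
    ∃ c : ℂ, ∀ s : ℂ, s.re < R →
      F s * deriv G s - deriv F s * G s = c * (f s * deriv g s - deriv f s * g s) := by
  have hd : ∀ s : ℂ, s.re < R → HasDerivAt (fun s => (F s * deriv G s - deriv F s * G s) /
      (f s * deriv g s - deriv f s * g s)) 0 s := fun s hs =>
    ((hF.hasDerivAt_wronskian hG hs).fun_div (hf.hasDerivAt_wronskian hg hs) (hne s hs)).congr_deriv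
      (by ring)
  have hR : ((R - 1 : ℝ) : ℂ).re < R := by simp
  refine ⟨(fun s => (F s * deriv G s - deriv F s * G s) /
    (f s * deriv g s - deriv f s * g s)) (R - 1 : ℝ), fun s hs => (div_eq_iff (hne s hs)).1 ?_⟩
  exact (isOpen_lt continuous_re continuous_const).is_const_of_deriv_eq_zero
    (convex_halfSpace_re_lt R).isPreconnected
    (fun u hu => (hd u hu).differentiableAt.differentiableWithinAt)
    (fun u hu => (hd u hu).deriv) hs hR

/-- The coefficients are the constant ratios of Wronskians given by Cramer's rule. -/
theorem IsLogSolution.exists_eq_comb {A B F f g : ℂ → ℂ} {R : ℝ}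
    (hF : IsLogSolution A B R F) (hf : IsLogSolution A B R f) (hg : IsLogSolution A B R g)
    (hne : ∀ s : ℂ, s.re < R → f s * deriv g s - deriv f s * g s ≠ 0) :
    ∃ a b : ℂ, ∀ s : ℂ, s.re < R → F s = a * f s + b * g s := by
  obtain ⟨a, ha⟩ := hF.exists_wronskian_eq_mul hg hf hg hne
  obtain ⟨b, hb⟩ := hf.exists_wronskian_eq_mul hF hf hg hne
  refine ⟨a, b, fun s hs => mul_right_cancel₀ (hne s hs) ?_⟩
  linear_combination f s * ha s hs + g s * hb s hs

/-! ### Associated bases and the sum of the exponents -/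

namespace LinearEquation

variable {E : LinearEquation} {x : OnePoint ℂ}

/-- Shrinking the disc: independence is kept by the identity theorem. -/
theorem IsAssociatedBasis.mono {R R' : ℝ} {e : Fin 2 → ℂ → ℂ} {v : Fin 2 → ℤ}
    {G : Matrix (Fin 2) (Fin 2) ℂ} (h : E.IsAssociatedBasis x R e v G) (hR : R' ≤ R) :
    E.IsAssociatedBasis x R' e v G where
  solution j s hs := h.solution j s (hs.trans_le hR)
  independent c hc := by
    refine h.independent c fun s hs => ?_
    have hana : AnalyticOnNhd ℂ (fun s => ∑ j, c j * e j s) {s : ℂ | s.re < R} := fun u hu => by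
      simp only [Fin.sum_univ_two]
      exact (analyticAt_const.mul (h.solution 0 u hu).1).add
        (analyticAt_const.mul (h.solution 1 u hu).1)
    have hR' : ((R' - 1 : ℝ) : ℂ).re < R' := by simp
    refine hana.eqOn_of_preconnected_of_eventuallyEq (fun _ _ => analyticAt_const)
      (convex_halfSpace_re_lt R).isPreconnected (hR'.trans_le hR) ?_ hs
    filter_upwards [halfPlane_mem_nhds hR'] with u hu using hc u hu
  valuation := h.valuation
  adapted := h.adapted
  decreasing := h.decreasing
  monodromy s hs := h.monodromy s (hs.trans_le hR)
  triangular := h.triangular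

/-- If every vector of one associated basis is a combination of the vectors of another one, with
an invertible matrix of coefficients, then its valuations are no larger in sum. -/
theorem IsAssociatedBasis.sum_valuation_le {R : ℝ} {e f : Fin 2 → ℂ → ℂ} {v w : Fin 2 → ℤ}
    {G K : Matrix (Fin 2) (Fin 2) ℂ} (he : E.IsAssociatedBasis x R e v G)
    (hf : E.IsAssociatedBasis x R f w K) {C : Matrix (Fin 2) (Fin 2) ℂ} (hC : C.det ≠ 0)
    (hef : ∀ s : ℂ, s.re < R → ∀ k, e k s = ∑ j, f j s * C j k) : v 0 + v 1 ≤ w 0 + w 1 := by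
  have key : ∀ j k, C j k ≠ 0 → v k ≤ w j := fun j k hjk =>
    hf.adapted (fun i => C i k) (v k) ((he.valuation k).1.congr fun s hs => by
      rw [hef s hs k]; exact Finset.sum_congr rfl fun i _ => mul_comm _ _) j hjk
  rw [Matrix.det_fin_two] at hC
  by_cases h : C 0 0 * C 1 1 = 0
  · rw [h, zero_sub, neg_ne_zero] at hC
    have h1 := key 0 1 (left_ne_zero_of_mul hC)
    have h2 := key 1 0 (right_ne_zero_of_mul hC)
    omega
  · have h1 := key 0 0 (left_ne_zero_of_mul h)
    have h2 := key 1 1 (right_ne_zero_of_mul h)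
    omega

/-- The normalized logarithm of a monodromy eigenvalue is unique. -/
theorem eq_of_exp_two_pi_I_eq {ρ σ : ℂ}
    (h : exp (2 * Real.pi * I * ρ) = exp (2 * Real.pi * I * σ))
    (h1 : 0 ≤ ρ.re) (h2 : ρ.re < 1) (h3 : 0 ≤ σ.re) (h4 : σ.re < 1) : ρ = σ := by
  obtain ⟨n, hn⟩ := Complex.exp_eq_exp_iff_exists_int.1 h
  have h5 : ρ = σ + n := by
    apply mul_left_cancel₀ two_pi_I_ne_zero
    linear_combination hn
  have h6 := congrArg Complex.re h5
  simp only [add_re, intCast_re] at h6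
  have h7 : (n : ℝ) < 1 := by linarith
  have h8 : (-1 : ℝ) < n := by linarith
  have h9 : n = 0 := by
    have : n < 1 := by exact_mod_cast h7
    have : -1 < n := by exact_mod_cast h8
    omega
  rw [h5, h9]
  simp

/-- The sum of the exponents does not depend on the associated basis: the valuations are
determined by the filtration, and the eigenvalues by the monodromy operator. -/
theorem IsAssociatedBasis.exponent_sum_unique {R : ℝ} {e f : Fin 2 → ℂ → ℂ} {v w : Fin 2 → ℤ}
    {G K : Matrix (Fin 2) (Fin 2) ℂ} {ρ σ : Fin 2 → ℂ} (he : E.IsAssociatedBasis x R e v G)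
    (hf : E.IsAssociatedBasis x R f w K)
    (hρ : ∀ j, exp (2 * Real.pi * I * ρ j) = G j j ∧ 0 ≤ (ρ j).re ∧ (ρ j).re < 1)
    (hσ : ∀ j, exp (2 * Real.pi * I * σ j) = K j j ∧ 0 ≤ (σ j).re ∧ (σ j).re < 1)
    (hspan : ∀ F, E.IsMultivaluedSolution x R F →
      ∃ a b : ℂ, ∀ s : ℂ, s.re < R → F s = a * f 0 s + b * f 1 s) :
    (v 0 + ρ 0) + (v 1 + ρ 1) = (w 0 + σ 0) + (w 1 + σ 1) := by
  choose a b hab using fun k => hspan (e k) (he.solution k)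
  set C : Matrix (Fin 2) (Fin 2) ℂ := !![a 0, a 1; b 0, b 1] with hCdef
  have hef : ∀ s : ℂ, s.re < R → ∀ k, e k s = ∑ j, f j s * C j k := by
    intro s hs k
    rw [hab k s hs, Fin.sum_univ_two]
    fin_cases k <;> simp [hCdef] <;> ring
  have hC : C.det ≠ 0 := by
    intro h0
    obtain ⟨c, hc, hCc⟩ := Matrix.exists_mulVec_eq_zero_iff.2 h0
    refine hc (he.independent c fun s hs => ?_)
    have h0' := congrFun hCc 0
    have h1' := congrFun hCc 1
    simp only [Matrix.mulVec, dotProduct, Fin.sum_univ_two, Pi.zero_apply] at h0' h1'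
    simp only [Fin.sum_univ_two, hef s hs]
    linear_combination f 0 s * h0' + f 1 s * h1'
  have hunit : IsUnit C.det := isUnit_iff_ne_zero.2 hC
  have hfe : ∀ s : ℂ, s.re < R → ∀ k, f k s = ∑ j, e j s * C⁻¹ j k := by
    intro s hs k
    have h1 := C.mul_nonsing_inv hunit
    have e0 := congrFun (congrFun h1 0) k
    have e1 := congrFun (congrFun h1 1) k
    simp only [Matrix.mul_apply, Fin.sum_univ_two] at e0 e1
    simp only [Fin.sum_univ_two, hef s hs]
    have e2 : f k s = f 0 s * (1 : Matrix (Fin 2) (Fin 2) ℂ) 0 k +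
        f 1 s * (1 : Matrix (Fin 2) (Fin 2) ℂ) 1 k := by
      fin_cases k <;> simp [Matrix.one_apply]
    linear_combination e2 - f 0 s * e0 - f 1 s * e1
  have hC' : C⁻¹.det ≠ 0 := by
    rw [Matrix.det_nonsing_inv]
    exact (hunit.ringInverse).ne_zero
  have hv : v 0 + v 1 = w 0 + w 1 :=
    le_antisymm (he.sum_valuation_le hf hC hef) (hf.sum_valuation_le he hC' hfe)
  -- the two monodromy matrices are conjugate
  have hconj : C * G = K * C := by
    have hcol : ∀ k, (fun j => (C * G) j k - (K * C) j k) = 0 := by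
      intro k
      refine hf.independent _ fun s hs => ?_
      have hs' : (s + 2 * Real.pi * I).re < R := by simpa using hs
      have m1 := he.monodromy s hs k
      rw [hef _ hs' k] at m1
      simp only [Fin.sum_univ_two, hf.monodromy s hs, hef s hs, Matrix.mul_apply] at m1 ⊢
      linear_combination -m1
    ext j k
    exact sub_eq_zero.1 (congrFun (hcol k) j)
  have hG : G = C⁻¹ * K * C := by
    rw [Matrix.mul_assoc, ← hconj, ← Matrix.mul_assoc, Matrix.nonsing_inv_mul _ hunit,
      Matrix.one_mul]
  have hdet : G.det = K.det := by
    rw [hG, Matrix.det_mul, Matrix.det_mul, mul_right_comm, ← Matrix.det_mul,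
      Matrix.nonsing_inv_mul _ hunit, Matrix.det_one, one_mul]
  have htr : G.trace = K.trace := by
    rw [hG, Matrix.mul_assoc, Matrix.trace_mul_comm, Matrix.mul_assoc,
      Matrix.mul_nonsing_inv _ hunit, Matrix.mul_one]
  rw [Matrix.det_fin_two, Matrix.det_fin_two, he.triangular, hf.triangular] at hdet
  rw [Matrix.trace_fin_two, Matrix.trace_fin_two] at htr
  have hprod : (G 0 0 - K 0 0) * (G 0 0 - K 1 1) = 0 := by
    linear_combination G 0 0 * htr - hdet
  have huniq : ∀ i j, G i i = K j j → ρ i = σ j := fun i j hij =>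
    eq_of_exp_two_pi_I_eq ((hρ i).1.trans (hij.trans (hσ j).1.symm)) (hρ i).2.1 (hρ i).2.2
      (hσ j).2.1 (hσ j).2.2
  have hv' : (v 0 : ℂ) + v 1 = w 0 + w 1 := by exact_mod_cast hv
  rcases mul_eq_zero.1 hprod with h0 | h0
  · rw [huniq 0 0 (sub_eq_zero.1 h0), huniq 1 1 (by linear_combination htr - h0)]
    linear_combination hv'
  · rw [huniq 0 1 (sub_eq_zero.1 h0), huniq 1 0 (by linear_combination htr - h0)]
    linear_combination hv'

/-! ### Exponents at a Fuchsian point -/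

/-- The equation at `x` in the logarithmic coordinate, with `A = t P - 1` and `B = t² Q`. -/
theorem isMultivaluedSolution_iff {A B : ℂ → ℂ} {R : ℝ}
    (hA : ∀ s : ℂ, s.re < R → exp s * E.pAt x (exp s) - 1 = A (exp s))
    (hB : ∀ s : ℂ, s.re < R → exp s ^ 2 * E.qAt x (exp s) = B (exp s)) (F : ℂ → ℂ) :
    E.IsMultivaluedSolution x R F ↔ IsLogSolution A B R F := by
  refine forall₂_congr fun s hs => and_congr_right fun _ => ?_
  rw [← hA s hs, ← hB s hs]
  ring_nf

theorem isAssociatedBasis_of_isFrobeniusPair {A B : ℂ → ℂ} {R : ℝ}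
    (hA : ∀ s : ℂ, s.re < R → exp s * E.pAt x (exp s) - 1 = A (exp s))
    (hB : ∀ s : ℂ, s.re < R → exp s ^ 2 * E.qAt x (exp s) = B (exp s))
    {l μ c : ℂ} {h H : ℂ → ℂ} (P : IsFrobeniusPair A B l μ c R h H) (hre : 0 ≤ μ.re) :
    E.IsAssociatedBasis x R ![frobeniusFst l h, frobeniusSnd l μ c h H] ![⌊l.re⌋, ⌊(l - μ).re⌋]
      !![exp (2 * Real.pi * I * l), 2 * Real.pi * I * c * exp (2 * Real.pi * I * l);
        0, exp (2 * Real.pi * I * (l - μ))] := by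
  have hdec : ⌊(l - μ).re⌋ ≤ ⌊l.re⌋ := Int.floor_le_floor (by simpa using hre)
  have hadapted : ∀ (c' : Fin 2 → ℂ) (k : ℤ),
      LeveltGE (fun s => ∑ j, c' j * ![frobeniusFst l h, frobeniusSnd l μ c h H] j s) k →
      ∀ j, c' j ≠ 0 → k ≤ ![⌊l.re⌋, ⌊(l - μ).re⌋] j := by
    intro c' k hk j hj
    simp only [Fin.sum_univ_two, Matrix.cons_val_zero, Matrix.cons_val_one] at hk
    by_cases h1 : c' 1 = 0
    · have hj0 : j = 0 := by
        fin_cases j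
        · rfl
        · exact absurd h1 hj
      subst hj0
      simp only [h1, zero_mul, add_zero] at hk
      exact P.le_floor_of_leveltGE_fst (hk.of_const_mul hj)
    · have := P.le_floor_of_leveltGE_snd hre h1 hk
      fin_cases j
      · exact this.trans hdec
      · exact this
  refine ⟨fun j => ?_, fun c' hc' => ?_, fun j => ⟨?_, fun k hk => ?_⟩, hadapted, hdec,
    fun s hs k => ?_, rfl⟩
  · fin_cases j
    · exact (isMultivaluedSolution_iff hA hB _).2 P.solution_fst
    · exact (isMultivaluedSolution_iff hA hB _).2 P.solution_snd
  · funext j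
    by_contra hj
    -- the zero function has infinite valuation
    have hz : ∀ k, LeveltGE (fun _ => 0) k := fun k l _ c d _ => by
      simpa using tendsto_const_nhds
    have := hadapted c' (![⌊l.re⌋, ⌊(l - μ).re⌋] j + 1)
      ((hz _).congr fun s hs => (hc' s hs).symm) j hj
    omega
  · fin_cases j
    · exact P.leveltGE_fst
    · exact P.leveltGE_snd hre
  · refine hadapted (Pi.single j 1) k ?_ j (by simp)
    have : (fun s => ∑ i, (Pi.single j 1 : Fin 2 → ℂ) i *
        ![frobeniusFst l h, frobeniusSnd l μ c h H] i s) =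
        ![frobeniusFst l h, frobeniusSnd l μ c h H] j := by
      ext s
      rw [Finset.sum_eq_single j (fun i _ hi => by simp [hi]) (by simp)]
      simp
    rw [this]
    exact hk
  · fin_cases k
    · simpa [Fin.sum_univ_two, mul_comm] using IsFrobeniusPair.fst_add_two_pi_I l h s
    · simpa [Fin.sum_univ_two] using P.snd_add_two_pi_I s

/-- A pole of order at most `n` is removed by the factor `tⁿ`. -/
theorem exists_analyticAt_eq_pow_mul {f : ℂ → ℂ} (n : ℕ) (hf : MeromorphicAt f 0)
    (hn : -(n : ℤ) ≤ meromorphicOrderAt f 0) :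
    ∃ g : ℂ → ℂ, AnalyticAt ℂ g 0 ∧ ∀ᶠ t in 𝓝[≠] (0 : ℂ), t ^ n * f t = g t := by
  have hid : MeromorphicAt (fun t : ℂ => t ^ n) 0 := (analyticAt_id.pow n).meromorphicAt
  have hm : MeromorphicAt (fun t => t ^ n * f t) 0 := hid.fun_mul hf
  have ho : meromorphicOrderAt (fun t : ℂ => t ^ n) 0 = (n : ℤ) := by
    rw [meromorphicOrderAt_eq_int_iff hid]
    exact ⟨fun _ => 1, analyticAt_const, one_ne_zero, by simp⟩
  have h0 : 0 ≤ meromorphicOrderAt (fun t => t ^ n * f t) 0 := by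
    rw [fun_meromorphicOrderAt_mul hid hf, ho]
    induction h : meromorphicOrderAt f 0 with
    | top => simp
    | coe m =>
      rw [h] at hn
      have : -(n : ℤ) ≤ m := by exact_mod_cast hn
      have : 0 ≤ (n : ℤ) + m := by omega
      exact_mod_cast this
  exact ⟨_, hm.meromorphicOrderAt_nonneg_iff_analyticAt_toMeromorphicNFAt.1 h0,
    hm.eq_nhdsNE_toMeromorphicNFAt⟩

/-- At a Fuchsian point the indicial equation determines the sum of the exponents: it is `1 - a`
if `a` is the residue of the coefficient of `dy/dt`. -/
theorem exponent_sum_eq_one_iff (hE : E.IsFuchsianAt x) :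
    (∃ β : Fin 2 → ℂ, E.HasExponents x β ∧ β 0 + β 1 = 1) ↔
      0 ≤ meromorphicOrderAt (E.pAt x) 0 := by
  obtain ⟨hp, hq, hp1, hq2⟩ := hE
  obtain ⟨A₁, hA₁, hA₁e⟩ := exists_analyticAt_eq_pow_mul 1 hp hp1
  obtain ⟨B, hB, hBe⟩ := exists_analyticAt_eq_pow_mul 2 hq hq2
  set A : ℂ → ℂ := fun t => A₁ t - 1 with hAdef
  have hA : AnalyticAt ℂ A 0 := hA₁.sub analyticAt_const
  -- the roots `l`, `l - μ` of the indicial equation, the first with the larger real part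
  obtain ⟨l, μ, hl, hμ, hre⟩ : ∃ l μ : ℂ, l ^ 2 + A 0 * l + B 0 = 0 ∧ μ = 2 * l + A 0 ∧
      0 ≤ μ.re := by
    obtain ⟨d, hd⟩ := IsAlgClosed.exists_pow_nat_eq (A 0 ^ 2 - 4 * B 0) (n := 2) (by norm_num)
    rcases le_total 0 d.re with h | h
    · exact ⟨(-A 0 + d) / 2, d, by linear_combination hd / 4, by ring, h⟩
    · exact ⟨(-A 0 - d) / 2, -d, by linear_combination hd / 4, by ring, by simpa using h⟩
  obtain ⟨c, R₁, h, H, P⟩ := exists_isFrobeniusPair hA hB hl hμ hre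
  obtain ⟨R₂, hR₂⟩ := exists_forall_exp_of_eventually
    (eventually_nhdsWithin_iff.1 (hA₁e.and hBe))
  have hA' : ∀ s : ℂ, s.re < R₂ → exp s * E.pAt x (exp s) - 1 = A (exp s) := fun s hs => by
    simp only [hAdef]
    rw [← (hR₂ s hs (exp_ne_zero s)).1, pow_one]
  have hB' : ∀ s : ℂ, s.re < R₂ → exp s ^ 2 * E.qAt x (exp s) = B (exp s) := fun s hs =>
    (hR₂ s hs (exp_ne_zero s)).2
  have hexists : ∀ R, R ≤ R₁ → R ≤ R₂ → E.IsAssociatedBasis x R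
      ![frobeniusFst l h, frobeniusSnd l μ c h H] ![⌊l.re⌋, ⌊(l - μ).re⌋]
      !![exp (2 * Real.pi * I * l), 2 * Real.pi * I * c * exp (2 * Real.pi * I * l);
        0, exp (2 * Real.pi * I * (l - μ))] := fun R h1 h2 =>
    isAssociatedBasis_of_isFrobeniusPair (fun s hs => hA' s (hs.trans_le h2))
      (fun s hs => hB' s (hs.trans_le h2)) (P.mono h1) hre
  have hexp : ∀ b : ℂ, exp (2 * Real.pi * I * (b - ⌊b.re⌋)) = exp (2 * Real.pi * I * b) ∧
      0 ≤ (b - ⌊b.re⌋).re ∧ (b - ⌊b.re⌋).re < 1 := by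
    intro b
    refine ⟨?_, by simp, by simpa using Int.fract_lt_one b.re⟩
    rw [mul_sub, mul_comm _ ((⌊b.re⌋ : ℤ) : ℂ), Complex.exp_sub, exp_int_mul_two_pi_mul_I, div_one]
  have hρ : ∀ j, exp (2 * Real.pi * I * ![l - ⌊l.re⌋, l - μ - ⌊(l - μ).re⌋] j) =
      !![exp (2 * Real.pi * I * l), 2 * Real.pi * I * c * exp (2 * Real.pi * I * l);
        0, exp (2 * Real.pi * I * (l - μ))] j j ∧ 0 ≤ (![l - ⌊l.re⌋, l - μ - ⌊(l - μ).re⌋] j).re ∧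
        (![l - ⌊l.re⌋, l - μ - ⌊(l - μ).re⌋] j).re < 1 := by
    intro j
    fin_cases j
    · exact hexp l
    · exact hexp (l - μ)
  have hsum : (∃ β : Fin 2 → ℂ, E.HasExponents x β ∧ β 0 + β 1 = 1) ↔ A 0 = -1 := by
    constructor
    · rintro ⟨β, ⟨R, e, v, G, ρ, he, hρ', hβ⟩, hsum⟩
      set R' := min R (min R₁ R₂) with hR'
      have h1 : R' ≤ R₁ := (min_le_right _ _).trans (min_le_left _ _)
      have h2 : R' ≤ R₂ := (min_le_right _ _).trans (min_le_right _ _)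
      have key := (he.mono (min_le_left R (min R₁ R₂))).exponent_sum_unique (hexists R' h1 h2) hρ'
        hρ fun F hF => by
          have P' := P.mono h1
          exact ((isMultivaluedSolution_iff (fun s hs => hA' s (hs.trans_le h2))
            (fun s hs => hB' s (hs.trans_le h2)) F).1 hF).exists_eq_comb P'.solution_fst
            P'.solution_snd P'.wronskian
      rw [← hβ 0, ← hβ 1, hsum] at key
      simp at key
      linear_combination key - hμ
    · intro hA0
      refine ⟨![l, l - μ], ⟨min R₁ R₂, _, _, _, ![l - ⌊l.re⌋, l - μ - ⌊(l - μ).re⌋],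
        hexists _ (min_le_left _ _) (min_le_right _ _), hρ, fun j => ?_⟩, ?_⟩
      · fin_cases j <;> simp
      · simp
        linear_combination -hμ - hA0
  rw [hsum]
  have hA10 : A 0 = -1 ↔ A₁ 0 = 0 := by
    simp only [hAdef]
    constructor <;> intro h <;> linear_combination h
  rw [hA10]
  have hid : MeromorphicAt (fun t : ℂ => t) 0 := analyticAt_id.meromorphicAt
  have ho : meromorphicOrderAt A₁ 0 = 1 + meromorphicOrderAt (E.pAt x) 0 := by
    rw [← meromorphicOrderAt_congr hA₁e]
    simp only [pow_one]
    rw [fun_meromorphicOrderAt_mul hid hp]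
    congr 1
    exact meromorphicOrderAt_id
  -- `A₁ = t P` has one zero more than `P`
  have hpos : A₁ 0 = 0 ↔ 0 < meromorphicOrderAt A₁ 0 := by
    rw [← tendsto_zero_iff_meromorphicOrderAt_pos hA₁.meromorphicAt]
    have hlim := hA₁.continuousAt.tendsto.mono_left (nhdsWithin_le_nhds (s := {0}ᶜ))
    exact ⟨fun h => by rwa [h] at hlim, fun h => tendsto_nhds_unique hlim h⟩
  rw [hpos, ho]
  induction h : meromorphicOrderAt (E.pAt x) 0 with
  | top => simp
  | coe m =>
    have : (0 : ℤ) < 1 + m ↔ 0 ≤ m := by omega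
    exact_mod_cast this

end LinearEquation

/-! ### Möbius transformations in the local coordinates of the sphere -/

/-- The denominator of the Möbius transformation with matrix `g`. -/
noncomputable def mobDen (g : GL (Fin 2) ℂ) (z : ℂ) : ℂ := g 1 0 * z + g 1 1

/-- The Möbius transformation with matrix `g` in the affine coordinate; it has the meaningless
value `0` at the pole. -/
noncomputable def mob (g : GL (Fin 2) ℂ) (z : ℂ) : ℂ := (g 0 0 * z + g 0 1) / mobDen g z

theorem smul_coe_of_mobDen_ne_zero {g : GL (Fin 2) ℂ} {z : ℂ} (h : mobDen g z ≠ 0) :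
    g • (z : OnePoint ℂ) = (mob g z : ℂ) := by
  rw [OnePoint.smul_some_eq_ite]
  exact if_neg h

theorem smul_coe_of_mobDen_eq_zero {g : GL (Fin 2) ℂ} {z : ℂ} (h : mobDen g z = 0) :
    g • (z : OnePoint ℂ) = ∞ := by
  rw [OnePoint.smul_some_eq_ite]
  exact if_pos h

theorem mobDen_mul (g k : GL (Fin 2) ℂ) {z : ℂ} (h : mobDen k z ≠ 0) :
    mobDen (g * k) z = mobDen g (mob k z) * mobDen k z := by
  have : mob k z * mobDen k z = k 0 0 * z + k 0 1 := div_mul_cancel₀ _ h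
  simp only [mobDen, Units.val_mul, Matrix.mul_apply, Fin.sum_univ_two] at this ⊢
  linear_combination -(g 1 0 : ℂ) * this

theorem mob_mul (g k : GL (Fin 2) ℂ) {z : ℂ} (h : mobDen k z ≠ 0) :
    mob (g * k) z = mob g (mob k z) := by
  have h1 : mob k z * mobDen k z = k 0 0 * z + k 0 1 := div_mul_cancel₀ _ h
  rw [mob, mobDen_mul g k h, mob.eq_1 g, ← mul_div_mul_right _ (mobDen g (mob k z)) h]
  congr 1
  simp only [mobDen, Units.val_mul, Matrix.mul_apply, Fin.sum_univ_two] at h1 ⊢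
  linear_combination -(g 0 0 : ℂ) * h1

theorem det_ne_zero_of_GL (g : GL (Fin 2) ℂ) : (g 0 0 : ℂ) * g 1 1 - g 0 1 * g 1 0 ≠ 0 := by
  rw [← Matrix.det_fin_two]
  exact g.det_ne_zero

theorem eventually_affine_ne_zero {u v : ℂ} (h : u ≠ 0 ∨ v ≠ 0) (z : ℂ) :
    ∀ᶠ t in 𝓝[≠] z, u * t + v ≠ 0 := by
  by_cases hu : u = 0
  · have hv := h.resolve_left (not_not.2 hu)
    exact Eventually.of_forall fun t => by simpa [hu] using hv
  · have hcont : ContinuousAt (fun t : ℂ => t) z := continuousAt_id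
    have h1 : ∀ᶠ t in 𝓝[≠] z, t ≠ -v / u := by
      by_cases hz : z = -v / u
      · rw [← hz]; exact eventually_mem_nhdsWithin
      · exact (hcont.eventually_ne hz).filter_mono nhdsWithin_le_nhds
    filter_upwards [h1] with t ht h0
    exact ht (by rw [eq_div_iff hu]; linear_combination h0)

theorem eventually_mobDen_ne_zero (g : GL (Fin 2) ℂ) (z : ℂ) :
    ∀ᶠ t in 𝓝[≠] z, mobDen g t ≠ 0 := by
  refine eventually_affine_ne_zero ?_ z
  by_contra! h
  exact det_ne_zero_of_GL g (by rw [h.1, h.2]; ring)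

theorem analyticAt_mobDen (g : GL (Fin 2) ℂ) (z : ℂ) : AnalyticAt ℂ (mobDen g) z :=
  (analyticAt_const.mul analyticAt_id).add analyticAt_const

theorem analyticAt_mob {g : GL (Fin 2) ℂ} {z : ℂ} (h : mobDen g z ≠ 0) :
    AnalyticAt ℂ (mob g) z :=
  ((analyticAt_const.mul analyticAt_id).add analyticAt_const).div (analyticAt_mobDen g z) h

theorem hasDerivAt_mobDen (g : GL (Fin 2) ℂ) (z : ℂ) : HasDerivAt (mobDen g) (g 1 0 : ℂ) z :=
  (((hasDerivAt_id z).const_mul (g 1 0 : ℂ)).add_const (g 1 1 : ℂ)).congr_deriv (mul_one _)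

theorem hasDerivAt_mob {g : GL (Fin 2) ℂ} {z : ℂ} (h : mobDen g z ≠ 0) :
    HasDerivAt (mob g) (g.val.det / mobDen g z ^ 2) z := by
  have h1 : HasDerivAt (fun z => (g 0 0 : ℂ) * z + g 0 1) (g 0 0 : ℂ) z :=
    (((hasDerivAt_id z).const_mul (g 0 0 : ℂ)).add_const (g 0 1 : ℂ)).congr_deriv (mul_one _)
  refine (h1.div (hasDerivAt_mobDen g z) h).congr_deriv ?_
  rw [Matrix.det_fin_two]
  congr 1
  simp only [mobDen]
  ring

/-- The matrix of the Möbius transformation which is the local parametrization of the sphere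
at `x`. -/
noncomputable def sphereMatrix : OnePoint ℂ → GL (Fin 2) ℂ
  | ∞ => Matrix.GeneralLinearGroup.mkOfDetNeZero !![0, 1; 1, 0] (by simp)
  | (a : ℂ) => Matrix.GeneralLinearGroup.mkOfDetNeZero !![1, a; 0, 1] (by simp)

theorem sphereParam_eq_smul (x : OnePoint ℂ) (t : ℂ) :
    sphereParam x t = sphereMatrix x • (t : OnePoint ℂ) := by
  rw [OnePoint.smul_some_eq_ite]
  induction x using OnePoint.rec with
  | infty =>
    simp [sphereParam, sphereMatrix, Matrix.GeneralLinearGroup.mkOfDetNeZero]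
  | coe a =>
    simp [sphereParam, sphereMatrix, Matrix.GeneralLinearGroup.mkOfDetNeZero, add_comm]

theorem sphereParam_zero (x : OnePoint ℂ) : sphereParam x 0 = x := by
  induction x using OnePoint.rec with
  | infty => simp [sphereParam]
  | coe a => simp [sphereParam]

/-- The matrix of the Möbius transformation `z ↦ g • z` in the local coordinates at `x` and at
its image. -/
noncomputable def localMatrix (g : GL (Fin 2) ℂ) (x : OnePoint ℂ) : GL (Fin 2) ℂ :=
  (sphereMatrix (g • x))⁻¹ * g * sphereMatrix x

theorem sphereMatrix_mul_localMatrix (g : GL (Fin 2) ℂ) (x : OnePoint ℂ) :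
    sphereMatrix (g • x) * localMatrix g x = g * sphereMatrix x := by
  rw [localMatrix, mul_assoc, mul_inv_cancel_left]

/-- In local coordinates a Möbius transformation fixes the origin. -/
theorem localMatrix_fixes_zero (g : GL (Fin 2) ℂ) (x : OnePoint ℂ) :
    mobDen (localMatrix g x) 0 ≠ 0 ∧ mob (localMatrix g x) 0 = 0 := by
  have h : localMatrix g x • ((0 : ℂ) : OnePoint ℂ) = ((0 : ℂ) : OnePoint ℂ) := by
    rw [localMatrix, mul_smul, mul_smul, ← sphereParam_eq_smul, sphereParam_zero,
      inv_smul_eq_iff, ← sphereParam_eq_smul, sphereParam_zero]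
  have hd : mobDen (localMatrix g x) 0 ≠ 0 := fun h0 => by
    rw [smul_coe_of_mobDen_eq_zero h0] at h
    exact OnePoint.infty_ne_coe _ h
  rw [smul_coe_of_mobDen_ne_zero hd] at h
  exact ⟨hd, OnePoint.coe_injective h⟩

theorem eventually_smul_sphereParam (g : GL (Fin 2) ℂ) (x : OnePoint ℂ) :
    ∀ᶠ t in 𝓝 (0 : ℂ), g • sphereParam x t =
      sphereParam (g • x) (mob (localMatrix g x) t) := by
  filter_upwards [(analyticAt_mobDen (localMatrix g x) 0).continuousAt.eventually_ne
    (localMatrix_fixes_zero g x).1] with t ht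
  rw [sphereParam_eq_smul, sphereParam_eq_smul, ← smul_coe_of_mobDen_ne_zero ht, ← mul_smul,
    ← mul_smul, sphereMatrix_mul_localMatrix]

theorem map_sphereParam_nhds (x : OnePoint ℂ) : map (sphereParam x) (𝓝 0) = 𝓝 x := by
  induction x using OnePoint.rec with
  | infty =>
    rw [OnePoint.nhds_infty_eq, coclosedCompact_eq_cocompact, ← Metric.cobounded_eq_cocompact,
      ← Filter.inv_nhdsNE_zero, ← nhdsNE_sup_pure, map_sup, map_pure, sphereParam_zero]
    congr 1
    have : map (sphereParam ∞) (𝓝[≠] 0) =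
        map (fun t : ℂ => ((t⁻¹ : ℂ) : OnePoint ℂ)) (𝓝[≠] 0) := by
      refine Filter.map_congr ?_
      filter_upwards [self_mem_nhdsWithin] with t ht
      exact if_neg ht
    rw [this]
    rfl
  | coe a =>
    rw [OnePoint.nhds_coe_eq]
    have : sphereParam (a : OnePoint ℂ) = (fun z : ℂ => (z : OnePoint ℂ)) ∘ fun t => a + t := rfl
    rw [this, ← Filter.map_map]
    congr 1
    simp

/-- Continuity is checked in local coordinates, in which the map is holomorphic at `0`. -/
theorem continuous_GL_smul (g : GL (Fin 2) ℂ) : Continuous fun x : OnePoint ℂ => g • x := by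
  rw [continuous_iff_continuousAt]
  intro x
  rw [ContinuousAt, ← map_sphereParam_nhds x, tendsto_map'_iff, ← map_sphereParam_nhds (g • x)]
  have h := (analyticAt_mob (localMatrix_fixes_zero g x).1).continuousAt.tendsto
  rw [(localMatrix_fixes_zero g x).2] at h
  exact ((tendsto_map.comp h).congr' ((eventually_smul_sphereParam g x).mono fun t ht => ht.symm))

/-- The Möbius transformation with matrix `g` as a homeomorphism of the sphere. -/
noncomputable def mobHomeomorph (g : GL (Fin 2) ℂ) : OnePoint ℂ ≃ₜ OnePoint ℂ where
  toEquiv := MulAction.toPerm g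
  continuous_toFun := continuous_GL_smul g
  continuous_invFun := continuous_GL_smul g⁻¹

theorem HolomorphicNear.comp_smul {f : OnePoint ℂ → ℂ} {g : GL (Fin 2) ℂ} {x : OnePoint ℂ}
    (hf : HolomorphicNear f (g • x)) : HolomorphicNear (fun y => f (g • y)) x := by
  have h := analyticAt_mob (localMatrix_fixes_zero g x).1
  have hf' : AnalyticAt ℂ (fun t => f (sphereParam (g • x) t)) (mob (localMatrix g x) 0) := by
    rw [(localMatrix_fixes_zero g x).2]; exact hf
  refine (hf'.comp h).congr ?_
  filter_upwards [eventually_smul_sphereParam g x] with t ht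
  simp only [Function.comp_apply, ht]

/-! ### Pull-back of an equation under a Möbius transformation -/

/-- The coefficient of `dy/dz` after the substitution of `mob g z` for the variable. -/
noncomputable def pullP (g : GL (Fin 2) ℂ) (p : ℂ → ℂ) (z : ℂ) : ℂ :=
  p (mob g z) * (g.val.det / mobDen g z ^ 2) + 2 * g 1 0 / mobDen g z

/-- The coefficient of `y` after the substitution of `mob g z` for the variable. -/
noncomputable def pullQ (g : GL (Fin 2) ℂ) (q : ℂ → ℂ) (z : ℂ) : ℂ :=
  q (mob g z) * (g.val.det / mobDen g z ^ 2) ^ 2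

/-- Pull-backs compose contravariantly. Both sides are meaningful only off the poles. -/
theorem pullP_mul (g k : GL (Fin 2) ℂ) (p : ℂ → ℂ) {z : ℂ} (hk : mobDen k z ≠ 0)
    (hgk : mobDen (g * k) z ≠ 0) : pullP (g * k) p z = pullP k (pullP g p) z := by
  have hg : mobDen g (mob k z) ≠ 0 := by
    rw [mobDen_mul g k hk] at hgk
    exact left_ne_zero_of_mul hgk
  simp only [pullP, mob_mul g k hk, mobDen_mul g k hk, Units.val_mul, Matrix.det_mul]
  have h1 : (k 0 0 * z + k 0 1 : ℂ) = mob k z * mobDen k z := (div_mul_cancel₀ _ hk).symm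
  have h2 : (g.val * k.val) 1 0 * mobDen k z =
      g 1 0 * k.val.det + k 1 0 * (mobDen g (mob k z) * mobDen k z) := by
    simp only [Matrix.mul_apply, Fin.sum_univ_two, Matrix.det_fin_two]
    simp only [mobDen] at h1 ⊢
    linear_combination (g 1 0 : ℂ) * (k 1 0 : ℂ) * h1
  have h3 : (g.val * k.val) 1 0 =
      (g 1 0 * k.val.det + k 1 0 * (mobDen g (mob k z) * mobDen k z)) / mobDen k z :=
    (eq_div_iff hk).2 h2
  rw [h3]
  field_simp
  ring

theorem pullQ_mul (g k : GL (Fin 2) ℂ) (q : ℂ → ℂ) {z : ℂ} (hk : mobDen k z ≠ 0) :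
    pullQ (g * k) q z = pullQ k (pullQ g q) z := by
  simp only [pullQ, mob_mul g k hk, mobDen_mul g k hk, Units.val_mul, Matrix.det_mul]
  rw [mul_pow, mul_div_mul_comm]
  ring

theorem pullP_one (p : ℂ → ℂ) : pullP 1 p = p := by
  ext z; simp [pullP, mob, mobDen]

theorem pullQ_one (q : ℂ → ℂ) : pullQ 1 q = q := by
  ext z; simp [pullQ, mob, mobDen]

/-- The coefficient in a local coordinate is the pull-back under the local parametrization, also
at `∞`. -/
theorem LinearEquation.pAt_eq_pullP (E : LinearEquation) (x : OnePoint ℂ) :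
    E.pAt x = pullP (sphereMatrix x) E.p := by
  ext t
  induction x using OnePoint.rec with
  | infty =>
    simp [LinearEquation.pAt, pullP, mob, mobDen, sphereMatrix,
      Matrix.GeneralLinearGroup.mkOfDetNeZero]
    ring
  | coe a =>
    simp [LinearEquation.pAt, pullP, mob, mobDen, sphereMatrix,
      Matrix.GeneralLinearGroup.mkOfDetNeZero, add_comm]

theorem LinearEquation.qAt_eq_pullQ (E : LinearEquation) (x : OnePoint ℂ) :
    E.qAt x = pullQ (sphereMatrix x) E.q := by
  ext t
  induction x using OnePoint.rec with
  | infty =>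
    simp [LinearEquation.qAt, pullQ, mob, mobDen, sphereMatrix,
      Matrix.GeneralLinearGroup.mkOfDetNeZero]
    ring
  | coe a =>
    simp [LinearEquation.qAt, pullQ, mob, mobDen, sphereMatrix,
      Matrix.GeneralLinearGroup.mkOfDetNeZero, add_comm]

section Local

variable {T : GL (Fin 2) ℂ} {f : ℂ → ℂ}

theorem deriv_mob_ne_zero {z : ℂ} (h : mobDen T z ≠ 0) : deriv (mob T) z ≠ 0 := by
  rw [(hasDerivAt_mob h).deriv]
  exact div_ne_zero T.det_ne_zero (pow_ne_zero 2 h)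

theorem meromorphicAt_comp_mob (h : mobDen T 0 ≠ 0) (h0 : mob T 0 = 0) (hf : MeromorphicAt f 0) :
    MeromorphicAt (fun t => f (mob T t)) 0 ∧
      meromorphicOrderAt (fun t => f (mob T t)) 0 = meromorphicOrderAt f 0 := by
  have hf' : MeromorphicAt f (mob T 0) := by rwa [h0]
  refine ⟨hf'.comp_analyticAt (analyticAt_mob h), ?_⟩
  have := meromorphicOrderAt_comp_of_deriv_ne_zero (f := f) (analyticAt_mob h) (deriv_mob_ne_zero h)
  rwa [h0] at this

theorem analyticAt_det_div (h : mobDen T 0 ≠ 0) :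
    AnalyticAt ℂ (fun t => T.val.det / mobDen T t ^ 2) 0 :=
  analyticAt_const.div ((analyticAt_mobDen T 0).pow 2) (pow_ne_zero 2 h)

theorem meromorphicAt_pullP (h : mobDen T 0 ≠ 0) (h0 : mob T 0 = 0) (hf : MeromorphicAt f 0)
    {n : ℤ} (hn : n ≤ 0) (hfn : n ≤ meromorphicOrderAt f 0) :
    MeromorphicAt (pullP T f) 0 ∧ n ≤ meromorphicOrderAt (pullP T f) 0 := by
  obtain ⟨h1, h2⟩ := meromorphicAt_comp_mob h h0 hf
  have h3 := analyticAt_det_div h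
  have h4 : AnalyticAt ℂ (fun t => 2 * (T 1 0 : ℂ) / mobDen T t) 0 :=
    analyticAt_const.div (analyticAt_mobDen T 0) h
  have h5 := h1.fun_mul h3.meromorphicAt
  refine ⟨h5.fun_add h4.meromorphicAt, le_trans (le_min ?_ ?_)
    (meromorphicOrderAt_add h5 h4.meromorphicAt)⟩
  · have := meromorphicOrderAt_mul_of_ne_zero (f := fun t => f (mob T t)) h3
      (div_ne_zero T.det_ne_zero (pow_ne_zero 2 h))
    rw [mul_comm] at this
    exact hfn.trans (h2.symm.trans this.symm).le
  · exact le_trans (by exact_mod_cast hn) h4.meromorphicOrderAt_nonneg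

theorem meromorphicAt_pullQ (h : mobDen T 0 ≠ 0) (h0 : mob T 0 = 0) (hf : MeromorphicAt f 0) :
    MeromorphicAt (pullQ T f) 0 ∧
      meromorphicOrderAt (pullQ T f) 0 = meromorphicOrderAt f 0 := by
  obtain ⟨h1, h2⟩ := meromorphicAt_comp_mob h h0 hf
  have h3 := (analyticAt_det_div h).pow 2
  refine ⟨h1.fun_mul h3.meromorphicAt, ?_⟩
  have := meromorphicOrderAt_mul_of_ne_zero (f := fun t => f (mob T t)) h3
    (pow_ne_zero 2 (div_ne_zero T.det_ne_zero (pow_ne_zero 2 h)))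
  rw [mul_comm] at this
  exact this.trans h2

theorem mob_inv_zero (h : mobDen T 0 ≠ 0) (h0 : mob T 0 = 0) :
    mobDen T⁻¹ 0 ≠ 0 ∧ mob T⁻¹ 0 = 0 := by
  have h1 := mobDen_mul T⁻¹ T h
  have h2 := mob_mul T⁻¹ T h
  rw [inv_mul_cancel, h0] at h1 h2
  refine ⟨fun h3 => ?_, h2.symm.trans ?_⟩
  · rw [h3, zero_mul] at h1
    simp [mobDen] at h1
  · simp [mob]

/-- Near the fixed point `0`, pulling back under `T` and then under `T⁻¹` changes nothing. -/
theorem eventuallyEq_pull_inv {p p' q q' : ℂ → ℂ} (h : mobDen T 0 ≠ 0) (h0 : mob T 0 = 0)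
    (hp : p' =ᶠ[𝓝[≠] 0] pullP T p) (hq : q' =ᶠ[𝓝[≠] 0] pullQ T q) :
    p =ᶠ[𝓝[≠] 0] pullP T⁻¹ p' ∧ q =ᶠ[𝓝[≠] 0] pullQ T⁻¹ q' := by
  obtain ⟨h1, h2⟩ := mob_inv_zero h h0
  have hlim : Tendsto (mob T⁻¹) (𝓝[≠] 0) (𝓝[≠] 0) := by
    have := (analyticAt_mob h1).continuousAt.tendsto
    rw [h2] at this
    refine tendsto_nhdsWithin_iff.2 ⟨this.mono_left nhdsWithin_le_nhds, ?_⟩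
    have := (hasDerivAt_mob h1).eventually_ne (c := 0)
      (div_ne_zero (T⁻¹).det_ne_zero (pow_ne_zero 2 h1))
    exact this
  have hden := eventually_mobDen_ne_zero T⁻¹ 0
  constructor
  · filter_upwards [hlim.eventually hp, hden] with t ht hd
    have := pullP_mul T T⁻¹ p hd (by rw [mul_inv_cancel]; simp [mobDen])
    rw [mul_inv_cancel, pullP_one] at this
    rw [this]
    simp only [pullP] at ht ⊢
    rw [ht]
  · filter_upwards [hlim.eventually hq, hden] with t ht hd
    have := pullQ_mul T T⁻¹ q hd
    rw [mul_inv_cancel, pullQ_one] at this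
    rw [this]
    simp only [pullQ] at ht ⊢
    rw [ht]

end Local

namespace LinearEquation

open Classical in
/-- The pull-back of an equation under the Möbius transformation with matrix `g`. At the pole of
the transformation the coefficients are given their limits, if these exist. -/
noncomputable def pull (g : GL (Fin 2) ℂ) (E : LinearEquation) : LinearEquation where
  p z := if mobDen g z = 0 then toMeromorphicNFAt (pullP g E.p) z z else pullP g E.p z
  q z := if mobDen g z = 0 then toMeromorphicNFAt (pullQ g E.q) z z else pullQ g E.q z

variable {E : LinearEquation} {g : GL (Fin 2) ℂ}

theorem pull_p_of_ne {z : ℂ} (h : mobDen g z ≠ 0) : (E.pull g).p z = pullP g E.p z := if_neg h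

theorem pull_q_of_ne {z : ℂ} (h : mobDen g z ≠ 0) : (E.pull g).q z = pullQ g E.q z := if_neg h

/-- In local coordinates, the pulled back equation is the pull-back under a Möbius transformation
that fixes the origin. -/
theorem pull_eventuallyEq (E : LinearEquation) (g : GL (Fin 2) ℂ) (x : OnePoint ℂ) :
    (E.pull g).pAt x =ᶠ[𝓝[≠] 0] pullP (localMatrix g x) (E.pAt (g • x)) ∧
      (E.pull g).qAt x =ᶠ[𝓝[≠] 0] pullQ (localMatrix g x) (E.qAt (g • x)) := by
  have h : ∀ᶠ t in 𝓝[≠] (0 : ℂ), (E.pull g).pAt x t =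
      pullP (localMatrix g x) (E.pAt (g • x)) t ∧ (E.pull g).qAt x t =
      pullQ (localMatrix g x) (E.qAt (g • x)) t := by
    filter_upwards [eventually_mobDen_ne_zero (sphereMatrix x) 0,
      eventually_mobDen_ne_zero (g * sphereMatrix x) 0,
      eventually_mobDen_ne_zero (localMatrix g x) 0] with t h1 h2 h3
    have h4 : mobDen g (mob (sphereMatrix x) t) ≠ 0 := by
      have := h2
      rw [mobDen_mul _ _ h1] at this
      exact left_ne_zero_of_mul this
    rw [pAt_eq_pullP, pAt_eq_pullP, qAt_eq_pullQ, qAt_eq_pullQ,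
      ← pullP_mul _ _ _ h3 (by rwa [sphereMatrix_mul_localMatrix]), ← pullQ_mul _ _ _ h3,
      sphereMatrix_mul_localMatrix, pullP_mul _ _ _ h1 h2, pullQ_mul _ _ _ h1]
    constructor
    · rw [pullP, pull_p_of_ne h4]
      rfl
    · rw [pullQ, pull_q_of_ne h4]
      rfl
  exact ⟨h.mono fun t ht => ht.1, h.mono fun t ht => ht.2⟩

theorem pull_pAt_order {x : OnePoint ℂ} {n : ℤ} (hn : n ≤ 0)
    (h1 : MeromorphicAt (E.pAt (g • x)) 0) (h2 : n ≤ meromorphicOrderAt (E.pAt (g • x)) 0) :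
    MeromorphicAt ((E.pull g).pAt x) 0 ∧ n ≤ meromorphicOrderAt ((E.pull g).pAt x) 0 := by
  have he := (pull_eventuallyEq E g x).1
  obtain ⟨ha, hb⟩ := localMatrix_fixes_zero g x
  obtain ⟨hm, ho⟩ := meromorphicAt_pullP ha hb h1 hn h2
  exact ⟨hm.congr he.symm, by rwa [meromorphicOrderAt_congr he]⟩

theorem pull_qAt_order {x : OnePoint ℂ} (h1 : MeromorphicAt (E.qAt (g • x)) 0) :
    MeromorphicAt ((E.pull g).qAt x) 0 ∧
      meromorphicOrderAt ((E.pull g).qAt x) 0 = meromorphicOrderAt (E.qAt (g • x)) 0 := by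
  have he := (pull_eventuallyEq E g x).2
  obtain ⟨ha, hb⟩ := localMatrix_fixes_zero g x
  obtain ⟨hm, ho⟩ := meromorphicAt_pullQ ha hb h1
  exact ⟨hm.congr he.symm, by rwa [meromorphicOrderAt_congr he]⟩

theorem IsFuchsianAt.pull {x : OnePoint ℂ} (h : E.IsFuchsianAt (g • x)) :
    (E.pull g).IsFuchsianAt x := by
  obtain ⟨h1, h2, h3, h4⟩ := h
  have hp := pull_pAt_order (n := -1) (by norm_num) h1 h3
  have hq := pull_qAt_order h2
  exact ⟨hp.1, hq.1, hp.2, by rwa [hq.2]⟩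

theorem isOrdinaryAt_pull_iff {x : OnePoint ℂ} :
    (E.pull g).IsOrdinaryAt x ↔ E.IsOrdinaryAt (g • x) := by
  constructor
  · rintro ⟨h1, h2, h3, h4⟩
    obtain ⟨ha, hb⟩ := localMatrix_fixes_zero g x
    obtain ⟨ep, eq⟩ := eventuallyEq_pull_inv ha hb (pull_eventuallyEq E g x).1
      (pull_eventuallyEq E g x).2
    obtain ⟨ha', hb'⟩ := mob_inv_zero ha hb
    have hp := meromorphicAt_pullP ha' hb' h1 le_rfl h3
    have hq := meromorphicAt_pullQ ha' hb' h2
    refine ⟨hp.1.congr ep.symm, hq.1.congr eq.symm, ?_, ?_⟩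
    · rw [meromorphicOrderAt_congr ep]; exact hp.2
    · rwa [meromorphicOrderAt_congr eq, hq.2]
  · rintro ⟨h1, h2, h3, h4⟩
    have hp := pull_pAt_order le_rfl h1 h3
    have hq := pull_qAt_order h2
    exact ⟨hp.1, hq.1, hp.2, by rwa [hq.2]⟩

theorem analyticAt_of_add {f : ℂ → ℂ} {z : ℂ} (h : AnalyticAt ℂ (fun t => f (z + t)) 0) :
    AnalyticAt ℂ f z := by
  have h1 : AnalyticAt ℂ (fun u : ℂ => u - z) z := analyticAt_id.sub analyticAt_const
  have h2 : AnalyticAt ℂ (fun t => f (z + t)) (z - z) := by rwa [sub_self]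
  simpa [Function.comp_def] using h2.comp h1 (f := fun u : ℂ => u - z)

/-- If the corrected coefficient has no pole at a pole of `g`, it is holomorphic there. -/
theorem analyticAt_of_eq_toMeromorphicNFAt {f F : ℂ → ℂ} {z : ℂ}
    (hF : F z = toMeromorphicNFAt f z z) (hFf : ∀ u, mobDen g u ≠ 0 → F u = f u)
    (hm : MeromorphicAt (fun t => F (z + t)) 0)
    (ho : 0 ≤ meromorphicOrderAt (fun t => F (z + t)) 0) : AnalyticAt ℂ F z := by
  have hne : F =ᶠ[𝓝[≠] z] f := (eventually_mobDen_ne_zero g z).mono fun u hu => hFf u hu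
  have e1 : (fun t => F (z + t)) = F ∘ (fun t => z + t) := rfl
  have hlin : AnalyticAt ℂ (fun t : ℂ => z + t) 0 := analyticAt_const.add analyticAt_id
  have hder : deriv (fun t : ℂ => z + t) 0 ≠ 0 := by simp
  have hFm : MeromorphicAt F z := by
    have hsub : AnalyticAt ℂ (fun u : ℂ => u - z) z := analyticAt_id.sub analyticAt_const
    have h2 : MeromorphicAt (fun t => F (z + t)) (z - z) := by rwa [sub_self]
    simpa [Function.comp_def] using h2.comp_analyticAt (g := fun u : ℂ => u - z) hsub
  have hFo : 0 ≤ meromorphicOrderAt F z := by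
    rw [e1, meromorphicOrderAt_comp_of_deriv_ne_zero hlin hder, add_zero] at ho
    exact ho
  have hfm : MeromorphicAt f z := hFm.congr hne
  rw [meromorphicOrderAt_congr hne, hfm.meromorphicOrderAt_nonneg_iff_analyticAt_toMeromorphicNFAt]
    at hFo
  refine hFo.congr ?_
  have h3 := hfm.eq_nhdsNE_toMeromorphicNFAt
  filter_upwards [eventually_nhdsWithin_iff.1 (h3.symm.trans hne.symm)] with u hu
  by_cases huz : u = z
  · rw [huz, hF]
  · exact hu huz

/-- A Riemann equation is transported by a Möbius transformation. -/
theorem IsRiemann.pull {D D' : Set (OnePoint ℂ)} (hcard : D.ncard = 3)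
    (hD : ∀ x, x ∈ D ↔ g • x ∈ D') (h : E.IsRiemann D') : (E.pull g).IsRiemann D where
  card := hcard
  fuchsian x hx := (h.fuchsian _ ((hD x).1 hx)).pull
  singular x hx := fun hord => h.singular _ ((hD x).1 hx) (isOrdinaryAt_pull_iff.1 hord)
  ordinary x hx := isOrdinaryAt_pull_iff.2 (h.ordinary _ (fun hgx => hx ((hD x).2 hgx)))
  analytic z hz := by
    have hgz : g • (z : OnePoint ℂ) ∉ D' := fun hgx => hz ((hD _).2 hgx)
    by_cases h0 : mobDen g z = 0
    · obtain ⟨h1, h2, h3, h4⟩ := isOrdinaryAt_pull_iff.2 (h.ordinary _ hgz)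
      exact ⟨analyticAt_of_eq_toMeromorphicNFAt (if_pos h0) (fun u hu => if_neg hu) h1 h3,
        analyticAt_of_eq_toMeromorphicNFAt (if_pos h0) (fun u hu => if_neg hu) h2 h4⟩
    · rw [smul_coe_of_mobDen_ne_zero h0] at hgz
      obtain ⟨hp, hq⟩ := h.analytic _ hgz
      have hev := (analyticAt_mobDen g z).continuousAt.eventually_ne h0
      have hdet : AnalyticAt ℂ (fun t => g.val.det / mobDen g t ^ 2) z :=
        analyticAt_const.div ((analyticAt_mobDen g z).pow 2) (pow_ne_zero 2 h0)
      constructor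
      · refine AnalyticAt.congr (f := pullP g E.p) ?_
          (hev.mono fun u hu => (pull_p_of_ne hu).symm)
        exact ((hp.comp (analyticAt_mob h0)).mul hdet).add
          (analyticAt_const.div (analyticAt_mobDen g z) h0)
      · refine AnalyticAt.congr (f := pullQ g E.q) ?_
          (hev.mono fun u hu => (pull_q_of_ne hu).symm)
        exact (hq.comp (analyticAt_mob h0)).mul (hdet.pow 2)

/-! ### Transport of solutions and of the monodromy -/

/-- The chain rule for the substitution of `mob g z` for the variable. -/
theorem pull_solution_of_ne {f : OnePoint ℂ → ℂ} {z : ℂ} (h0 : mobDen g z ≠ 0)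
    (hf : HolomorphicNear f (g • (z : OnePoint ℂ)))
    (hode : deriv (deriv fun u : ℂ => f u) (mob g z)
      + E.p (mob g z) * deriv (fun u : ℂ => f u) (mob g z) + E.q (mob g z) * f (mob g z) = 0) :
    deriv (deriv fun u : ℂ => f (g • (u : OnePoint ℂ))) z
      + (E.pull g).p z * deriv (fun u : ℂ => f (g • (u : OnePoint ℂ))) z
      + (E.pull g).q z * f (g • (z : OnePoint ℂ)) = 0 := by
  rw [smul_coe_of_mobDen_ne_zero h0] at hf
  set w := mob g z with hw
  set k : ℂ → ℂ := fun u : ℂ => f u with hk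
  have hka : AnalyticAt ℂ k w := analyticAt_of_add hf
  have hev := (analyticAt_mobDen g z).continuousAt.eventually_ne h0
  have hfun : (fun u : ℂ => f (g • (u : OnePoint ℂ))) =ᶠ[𝓝 z] fun u => k (mob g u) := by
    filter_upwards [hev] with u hu
    rw [smul_coe_of_mobDen_ne_zero hu]
  have hcont : ∀ᶠ u in 𝓝 z, AnalyticAt ℂ k (mob g u) :=
    (analyticAt_mob h0).continuousAt.eventually hka.eventually_analyticAt
  have hd1 : deriv (fun u : ℂ => f (g • (u : OnePoint ℂ))) =ᶠ[𝓝 z]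
      fun u => deriv k (mob g u) * (g.val.det / mobDen g u ^ 2) := by
    refine hfun.deriv.trans ?_
    filter_upwards [hev, hcont] with u hu hau
    exact (hau.differentiableAt.hasDerivAt.comp u (hasDerivAt_mob hu)).deriv
  have hd2 : deriv (deriv (fun u : ℂ => f (g • (u : OnePoint ℂ)))) z =
      deriv (deriv k) w * (g.val.det / mobDen g z ^ 2) * (g.val.det / mobDen g z ^ 2) +
      deriv k w * (-(g.val.det * (2 * g 1 0)) / mobDen g z ^ 3) := by
    rw [hd1.deriv_eq]
    have h1 := hka.deriv.differentiableAt.hasDerivAt.comp z (hasDerivAt_mob h0)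
    have h2 : HasDerivAt (fun u => g.val.det / mobDen g u ^ 2)
        (-(g.val.det * (2 * g 1 0)) / mobDen g z ^ 3) z := by
      refine (((hasDerivAt_mobDen g z).fun_pow 2).fun_inv (pow_ne_zero 2 h0) |>.const_mul
        g.val.det).congr_deriv ?_
      field_simp
      push_cast
      ring
    exact (h1.mul h2).deriv
  rw [hd2, hd1.self_of_nhds, smul_coe_of_mobDen_ne_zero h0, pull_p_of_ne h0, pull_q_of_ne h0,
    pullP, pullQ, ← hw]
  have hk0 : f ((w : ℂ) : OnePoint ℂ) = k w := rfl
  rw [hk0] at hode ⊢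
  linear_combination (g.val.det / mobDen g z ^ 2) ^ 2 * hode

theorem IsSolutionNear.pull {D : Set (OnePoint ℂ)} (hR : (E.pull g).IsRiemann D)
    {f : OnePoint ℂ → ℂ} {x : OnePoint ℂ} (hx : x ∉ D) (hf : E.IsSolutionNear f (g • x)) :
    (E.pull g).IsSolutionNear (fun y => f (g • y)) x := by
  have hDfin : D.Finite := Set.finite_of_ncard_ne_zero (by rw [hR.card]; norm_num)
  have hf' := (continuous_GL_smul g).continuousAt.eventually hf
  filter_upwards [hf'.eventually_nhds, hDfin.isClosed.isOpen_compl.mem_nhds hx] with y hy hyD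
  refine ⟨hy.self_of_nhds.1.comp_smul, fun z hz => ?_⟩
  subst hz
  have hFa : AnalyticAt ℂ (fun u : ℂ => f (g • (u : OnePoint ℂ))) z :=
    analyticAt_of_add (f := fun u : ℂ => f (g • (u : OnePoint ℂ)))
      hy.self_of_nhds.1.comp_smul
  obtain ⟨hp, hq⟩ := hR.analytic z hyD
  -- the equation holds off the pole of `g`, hence at the pole by continuity
  have hana := (hFa.deriv.deriv.fun_add (hp.fun_mul hFa.deriv)).fun_add (hq.fun_mul hFa)
  refine tendsto_nhds_unique (hana.continuousAt.tendsto.mono_left nhdsWithin_le_nhds)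
    (tendsto_const_nhds.congr' (f₁ := fun _ => (0 : ℂ)) (l₁ := 𝓝[≠] z) ?_)
  have hy' : ∀ᶠ u : ℂ in 𝓝 z, HolomorphicNear f (g • (u : OnePoint ℂ)) ∧ ∀ w : ℂ,
      g • (u : OnePoint ℂ) = (w : OnePoint ℂ) → deriv (deriv fun u : ℂ => f u) w +
        E.p w * deriv (fun u : ℂ => f u) w + E.q w * f w = 0 :=
    OnePoint.continuous_coe.continuousAt.eventually hy
  filter_upwards [hy'.filter_mono nhdsWithin_le_nhds, eventually_mobDen_ne_zero g z] with u hu h0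
  exact (pull_solution_of_ne h0 hu.1 (hu.2 _ (smul_coe_of_mobDen_ne_zero h0))).symm

theorem IsFundamentalNear.pull {D : Set (OnePoint ℂ)} (hR : (E.pull g).IsRiemann D)
    {Y : Fin 2 → OnePoint ℂ → ℂ} {x : OnePoint ℂ} (hx : x ∉ D)
    (hY : E.IsFundamentalNear Y (g • x)) :
    (E.pull g).IsFundamentalNear (fun j y => Y j (g • y)) x := by
  refine ⟨fun j => (hY.1 j).pull hR hx, fun c hc => hY.2 c ?_⟩
  have hmap : map (fun y : OnePoint ℂ => g • y) (𝓝 x) = 𝓝 (g • x) :=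
    (mobHomeomorph g).map_nhds_eq x
  rw [← hmap]
  exact hc

end LinearEquation

theorem ContinuesAlong.comp_smul {g : GL (Fin 2) ℂ} {γ : unitInterval → OnePoint ℂ}
    {f h : OnePoint ℂ → ℂ} (H : ContinuesAlong (fun t => g • γ t) f h) :
    ContinuesAlong γ (fun y => f (g • y)) (fun y => h (g • y)) := by
  obtain ⟨F, h1, h2, h3, h4⟩ := H
  have hc : ∀ x : OnePoint ℂ, Tendsto (fun y : OnePoint ℂ => g • y) (𝓝 x) (𝓝 (g • x)) :=
    fun x => (continuous_GL_smul g).continuousAt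
  exact ⟨fun t y => F t (g • y), fun t => (h1 t).comp_smul,
    fun t => (h2 t).mono fun s hs => (hc _).eventually hs, (hc _).eventually h3,
    (hc _).eventually h4⟩

/-- The pulled back equation has the monodromy induced by the Möbius transformation. -/
theorem LinearEquation.HasMonodromy.pull {E : LinearEquation} {g : GL (Fin 2) ℂ}
    {D D' : Set (OnePoint ℂ)} (hR : (E.pull g).IsRiemann D) (f : C(↥Dᶜ, ↥D'ᶜ))
    (hf : ∀ x, (f x : OnePoint ℂ) = g • (x : OnePoint ℂ)) {x₀ : ↥Dᶜ} {y₀ : ↥D'ᶜ} (h₀ : f x₀ = y₀)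
    {χ : (FundamentalGroup ↥D'ᶜ y₀)ᵐᵒᵖ →* Matrix.SpecialLinearGroup (Fin 2) ℂ}
    (hχ : E.HasMonodromy χ) :
    (E.pull g).HasMonodromy (χ.comp (MonoidHom.op (FundamentalGroup.mapOfEq f h₀))) := by
  obtain ⟨Y, hY, hmon⟩ := hχ
  have hy₀ : (y₀ : OnePoint ℂ) = g • (x₀ : OnePoint ℂ) := by rw [← h₀, hf]
  rw [hy₀] at hY
  refine ⟨fun j y => Y j (g • y), hY.pull hR x₀.2, fun γ => ?_⟩
  obtain ⟨Z, hZ, hrel⟩ := hmon ((γ.map f.continuous).cast h₀.symm h₀.symm)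
  refine ⟨fun j y => Z j (g • y), fun j => ?_, ?_⟩
  · refine ContinuesAlong.comp_smul ?_
    have := hZ j
    simp only [Path.cast_coe, Path.map_coe, Function.comp_apply, hf] at this
    exact this
  · rw [hy₀] at hrel
    have h1 := (continuous_GL_smul g).continuousAt.eventually hrel
    filter_upwards [h1] with y hy j
    rw [hy j]
    refine Finset.sum_congr rfl fun k _ => ?_
    have e : FundamentalGroup.mapOfEq f h₀ (FundamentalGroup.fromPath ⟦γ⟧) =
        FundamentalGroup.fromPath ⟦(γ.map f.continuous).cast h₀.symm h₀.symm⟧ :=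
      (FundamentalGroup.mapOfEq_apply f h₀ _).trans rfl
    exact congrArg (fun G => Z k (g • y) * (χ (MulOpposite.op G)).val k j) e.symm

/-! ### Vanishing of the first order coefficient -/

namespace LinearEquation

variable {E : LinearEquation}

/-- An equation without first order term has the singular point `∞`, since `d²/dz²` acquires a
first order term with a pole in the coordinate `1 / z`. -/
theorem IsRiemannSturmLiouville.infty_mem {D : Set (OnePoint ℂ)}
    (h : E.IsRiemannSturmLiouville D) : ∞ ∈ D := by
  by_contra hD
  have hfin : D.Finite := Set.finite_of_ncard_ne_zero (by rw [h.riemann.card]; norm_num)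
  obtain ⟨h1, -, h3, -⟩ := h.riemann.ordinary ∞ hD
  have hnear : ∀ᶠ t in 𝓝 (0 : ℂ), sphereParam ∞ t ∉ D := by
    have := hfin.isClosed.isOpen_compl.mem_nhds hD
    rw [← map_sphereParam_nhds] at this
    exact this
  have he : E.pAt ∞ =ᶠ[𝓝[≠] 0] fun t => 2 * t⁻¹ := by
    filter_upwards [hnear.filter_mono nhdsWithin_le_nhds, self_mem_nhdsWithin] with t ht ht0
    have ht1 : sphereParam ∞ t = ((t⁻¹ : ℂ) : OnePoint ℂ) := if_neg ht0
    rw [ht1] at ht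
    simp only [pAt, h.no_first_order_term _ ht]
    ring
  rw [meromorphicOrderAt_congr he] at h3
  have h4 : meromorphicOrderAt (fun t : ℂ => 2 * t⁻¹) 0 = (-1 : ℤ) := by
    have hinv : MeromorphicAt (fun t : ℂ => t⁻¹) 0 := (MeromorphicAt.id 0).inv
    rw [meromorphicOrderAt_eq_int_iff ((MeromorphicAt.const 2 0).fun_mul hinv)]
    exact ⟨fun _ => 2, analyticAt_const, two_ne_zero, Eventually.of_forall fun t => by
      simp [mul_comm]⟩
  rw [h4] at h3
  exact absurd h3 (by decide)

/-- At the finite singular points of an equation without first order term, the first order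
coefficient has no pole. -/
theorem IsRiemannSturmLiouville.pAt_order {D : Set (OnePoint ℂ)}
    (h : E.IsRiemannSturmLiouville D) (a : ℂ) : 0 ≤ meromorphicOrderAt (E.pAt a) 0 := by
  have hfin : D.Finite := Set.finite_of_ncard_ne_zero (by rw [h.riemann.card]; norm_num)
  have hfin' : (D \ {(a : OnePoint ℂ)}).Finite := hfin.subset Set.sdiff_subset
  have hnear : ∀ᶠ t in 𝓝 (0 : ℂ), sphereParam a t ∉ D \ {(a : OnePoint ℂ)} := by
    have := hfin'.isClosed.isOpen_compl.mem_nhds (x := (a : OnePoint ℂ)) (by simp)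
    rw [← map_sphereParam_nhds] at this
    exact this
  have he : E.pAt a =ᶠ[𝓝[≠] 0] fun _ => 0 := by
    filter_upwards [hnear.filter_mono nhdsWithin_le_nhds, self_mem_nhdsWithin] with t ht ht0
    refine h.no_first_order_term _ fun hD => ht ⟨hD, fun h1 => ht0 ?_⟩
    have : a + t = a := OnePoint.coe_injective h1
    simpa using this
  rw [meromorphicOrderAt_congr he]
  exact analyticAt_const.meromorphicOrderAt_nonneg

/-- If the first order coefficient has no pole at the finite singular points, it is entire; as
`∞` is a Fuchsian point it tends to `0` at `∞`, and vanishes by Liouville's theorem. -/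
theorem IsRiemann.isRiemannSturmLiouville {D : Set (OnePoint ℂ)} (h : E.IsRiemann D)
    (hinf : ∞ ∈ D) (hp : ∀ a : ℂ, (a : OnePoint ℂ) ∈ D → 0 ≤ meromorphicOrderAt (E.pAt a) 0) :
    E.IsRiemannSturmLiouville D := by
  refine ⟨h, ?_⟩
  have hfin : D.Finite := Set.finite_of_ncard_ne_zero (by rw [h.card]; norm_num)
  have hord : ∀ a : ℂ, MeromorphicAt (fun t => E.p (a + t)) 0 ∧
      0 ≤ meromorphicOrderAt (fun t => E.p (a + t)) 0 := by
    intro a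
    by_cases ha : (a : OnePoint ℂ) ∈ D
    · exact ⟨(h.fuchsian _ ha).1, hp a ha⟩
    · exact ⟨(h.ordinary _ ha).1, (h.ordinary _ ha).2.2.1⟩
  have hmer : ∀ a : ℂ, MeromorphicAt E.p a ∧ 0 ≤ meromorphicOrderAt E.p a := by
    intro a
    have hlin : AnalyticAt ℂ (fun t : ℂ => a + t) 0 := analyticAt_const.add analyticAt_id
    have hsub : AnalyticAt ℂ (fun u : ℂ => u - a) a := analyticAt_id.sub analyticAt_const
    have h2 : MeromorphicAt (fun t => E.p (a + t)) (a - a) := by rw [sub_self]; exact (hord a).1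
    refine ⟨by simpa [Function.comp_def] using
      h2.comp_analyticAt (g := fun u : ℂ => u - a) hsub, ?_⟩
    have := meromorphicOrderAt_comp_of_deriv_ne_zero (f := E.p) hlin (by simp)
    rw [add_zero] at this
    rw [← this]
    exact (hord a).2
  have hmerOn : MeromorphicOn E.p Set.univ := fun a _ => (hmer a).1
  set P := toMeromorphicNFOn E.p Set.univ with hP
  have hPana : ∀ z, AnalyticAt ℂ P z := by
    intro z
    rw [← (meromorphicNFOn_toMeromorphicNFOn E.p Set.univ
      (Set.mem_univ z)).meromorphicOrderAt_nonneg_iff_analyticAt,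
      meromorphicOrderAt_toMeromorphicNFOn hmerOn (Set.mem_univ z)]
    exact (hmer z).2
  have hPp : ∀ z : ℂ, (z : OnePoint ℂ) ∉ D → P z = E.p z := by
    intro z hz
    rw [hP, toMeromorphicNFOn_eq_toMeromorphicNFAt hmerOn (Set.mem_univ z),
      toMeromorphicNFAt_eq_self.2 (h.analytic z hz).1.meromorphicNFAt]
  -- near `∞` the Fuchsian condition reads `t⁻¹ p(t⁻¹) = O(1)`
  obtain ⟨hm, -, ho, -⟩ := h.fuchsian ∞ hinf
  obtain ⟨A, hA, hAe⟩ := exists_analyticAt_eq_pow_mul 1 hm ho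
  have hlim : Tendsto (fun t => P t⁻¹) (𝓝[≠] 0) (𝓝 0) := by
    have hfin' : (D \ {∞}).Finite := hfin.subset Set.sdiff_subset
    have hnear : ∀ᶠ t in 𝓝 (0 : ℂ), sphereParam ∞ t ∉ D \ {∞} := by
      have := hfin'.isClosed.isOpen_compl.mem_nhds (x := (∞ : OnePoint ℂ)) (by simp)
      rw [← map_sphereParam_nhds] at this
      exact this
    have hl : Tendsto (fun t : ℂ => t * (2 - A t)) (𝓝[≠] 0) (𝓝 0) := by
      have hc : ContinuousAt (fun t : ℂ => t * (2 - A t)) 0 :=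
        continuousAt_id.mul (continuousAt_const.sub hA.continuousAt)
      have := hc.tendsto.mono_left (nhdsWithin_le_nhds (s := {0}ᶜ))
      rwa [zero_mul] at this
    refine hl.congr' ?_
    filter_upwards [hnear.filter_mono nhdsWithin_le_nhds, self_mem_nhdsWithin, hAe]
      with t ht ht0 hAt
    have ht0' : t ≠ 0 := ht0
    have ht1 : sphereParam ∞ t = ((t⁻¹ : ℂ) : OnePoint ℂ) := if_neg ht0
    rw [ht1] at ht
    rw [hPp _ fun hD => ht ⟨hD, OnePoint.coe_ne_infty _⟩, ← hAt]
    simp only [pAt]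
    field_simp
    ring
  have hlim' : Tendsto P (cocompact ℂ) (𝓝 0) := by
    rw [← Metric.cobounded_eq_cocompact]
    exact (hlim.comp tendsto_inv₀_cobounded').congr fun z => by simp
  have hPd : Differentiable ℂ P := fun z => (hPana z).differentiableAt
  intro z hz
  rw [← hPp z hz]
  exact hPd.apply_eq_of_tendsto_cocompact z hlim'

end LinearEquation

/-- Every point can be moved to `∞` by a Möbius transformation. -/
theorem exists_smul_eq_infty (c : OnePoint ℂ) : ∃ g : GL (Fin 2) ℂ, g • c = ∞ := by
  refine ⟨(sphereMatrix c * (sphereMatrix ∞)⁻¹)⁻¹, ?_⟩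
  rw [inv_smul_eq_iff, mul_smul]
  have h1 := sphereParam_eq_smul ∞ 0
  have h2 := sphereParam_eq_smul c 0
  rw [sphereParam_zero] at h1 h2
  rw [inv_smul_eq_iff.2 h1]
  exact h2

theorem mainTheorem6 (D : Set (OnePoint ℂ)) (hD : D.ncard = 3) (x₀ : ↥Dᶜ)
    (χ : (FundamentalGroup ↥Dᶜ x₀)ᵐᵒᵖ →* Matrix.SpecialLinearGroup (Fin 2) ℂ) :
    RealizableByRSL χ ↔
      ∃ E : LinearEquation, E.IsRiemann D ∧ E.HasMonodromy χ ∧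
        ∃ a ∈ D, ∃ b ∈ D, a ≠ b ∧
          (∃ β : Fin 2 → ℂ, E.HasExponents a β ∧ β 0 + β 1 = 1) ∧
          (∃ β : Fin 2 → ℂ, E.HasExponents b β ∧ β 0 + β 1 = 1) := by
  constructor
  · rintro ⟨φ, ⟨g, hg⟩, E, hE, ψ, hψ, rfl⟩
    have hmem : ∀ x, x ∈ D ↔ g • x ∈ φ '' D := fun x => by
      rw [← hg, φ.injective.mem_set_image]
    have hR : (E.pull g).IsRiemann D := hE.riemann.pull hD hmem
    have hexp : ∀ x ∈ D, g • x ≠ ∞ →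
        ∃ β : Fin 2 → ℂ, (E.pull g).HasExponents x β ∧ β 0 + β 1 = 1 := by
      intro x hx hne
      rw [LinearEquation.exponent_sum_eq_one_iff (hR.fuchsian x hx)]
      obtain ⟨a, ha⟩ := OnePoint.ne_infty_iff_exists.1 hne
      have hfu := (hE.riemann.fuchsian _ ((hmem x).1 hx)).1
      refine (LinearEquation.pull_pAt_order le_rfl hfu ?_).2
      rw [← ha]
      exact hE.pAt_order a
    -- `a` and `b` are the two points that are not sent to `∞`
    obtain ⟨c, hcD, hc⟩ := hE.infty_mem
    have hcard : (D \ {c}).ncard = 2 := by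
      rw [Set.ncard_sdiff_singleton_of_mem hcD, hD]
    obtain ⟨a, b, hab, hset⟩ := Set.ncard_eq_two.1 hcard
    have ha : a ∈ D \ {c} := hset ▸ Set.mem_insert a {b}
    have hb : b ∈ D \ {c} := hset ▸ Set.mem_insert_of_mem a rfl
    have hne : ∀ x ∈ D \ {c}, g • x ≠ ∞ := fun x hx h => by
      rw [← hg, ← hc] at h
      exact hx.2 (φ.injective h)
    refine ⟨E.pull g, hR, ?_, a, ha.1, b, hb.1, hab, hexp a ha.1 (hne a ha), hexp b hb.1 (hne b hb)⟩
    have hmap : FundamentalGroup.mapOfEq (puncturedMap φ D) rfl =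
        FundamentalGroup.map (puncturedMap φ D) x₀ :=
      MonoidHom.ext fun p => by
        rw [FundamentalGroup.mapOfEq_apply]
        induction p using Quotient.inductionOn with
        | _ γ => rfl
    have := hψ.pull hR (puncturedMap φ D) (fun x => hg x) rfl
    rwa [hmap] at this
  · rintro ⟨E, hE, hχ, a, ha, b, hb, hab, hβa, hβb⟩
    obtain ⟨c, hc⟩ : ∃ c, D \ {a, b} = {c} := by
      rw [← Set.ncard_eq_one, Set.ncard_sdiff (Set.pair_subset ha hb), hD, Set.ncard_pair hab]
    have hcD : c ∈ D := (hc.symm ▸ Set.mem_singleton c : c ∈ D \ {a, b}).1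
    -- the third singular point is moved to `∞`, and the equation is pulled back by the inverse
    obtain ⟨g, hg⟩ := exists_smul_eq_infty c
    set φ := mobHomeomorph g with hφ
    have hφg : ∀ x, φ x = g • x := fun _ => rfl
    have hmem : ∀ y, y ∈ φ '' D ↔ g⁻¹ • y ∈ D := by
      intro y
      constructor
      · rintro ⟨x, hx, rfl⟩
        rwa [hφg, inv_smul_smul]
      · intro hy
        exact ⟨_, hy, by rw [hφg, smul_inv_smul]⟩
    have hR : (E.pull g⁻¹).IsRiemann (φ '' D) :=
      hE.pull (by rw [Set.ncard_image_of_injective _ φ.injective, hD]) hmem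
    have hRSL : (E.pull g⁻¹).IsRiemannSturmLiouville (φ '' D) := by
      refine hR.isRiemannSturmLiouville ⟨c, hcD, hg⟩ fun z hz => ?_
      obtain ⟨x, hx, hxz⟩ := hz
      have hgx : g⁻¹ • (z : OnePoint ℂ) = x := by rw [← hxz, hφg, inv_smul_smul]
      have hxab : x = a ∨ x = b := by
        by_contra! hne
        have : x ∈ D \ {a, b} := ⟨hx, by simp [hne]⟩
        rw [hc, Set.mem_singleton_iff] at this
        rw [this, hφg, hg] at hxz
        exact OnePoint.infty_ne_coe _ hxz
      refine (LinearEquation.pull_pAt_order (n := 0) le_rfl ?_ ?_).2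
      · rw [hgx]; exact (hE.fuchsian x hx).1
      · rw [hgx]
        refine (LinearEquation.exponent_sum_eq_one_iff (hE.fuchsian x hx)).1 ?_
        rcases hxab with rfl | rfl
        · exact hβa
        · exact hβb
    let f : C(↥(φ '' D)ᶜ, ↥Dᶜ) :=
      ⟨fun y => ⟨g⁻¹ • (y : OnePoint ℂ), fun h => y.2 ((hmem _).2 h)⟩,
        ((continuous_GL_smul g⁻¹).comp continuous_subtype_val).subtype_mk _⟩
    have hf : f (puncturedMap φ D x₀) = x₀ := Subtype.ext (inv_smul_smul g (x₀ : OnePoint ℂ))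
    refine ⟨φ, ⟨g, hφg⟩, E.pull g⁻¹, hRSL, χ.comp (MonoidHom.op (FundamentalGroup.mapOfEq f hf)),
      hχ.pull hR f (fun _ => rfl) hf, ?_⟩
    ext1 x
    have key : FundamentalGroup.mapOfEq f hf
        (FundamentalGroup.map (puncturedMap φ D) x₀ x.unop) = x.unop := by
      rw [FundamentalGroup.mapOfEq_apply]
      obtain ⟨p⟩ := x
      induction p using Quotient.inductionOn with
      | _ γ =>
        refine congrArg (Quotient.mk _) (Path.ext (funext fun t => Subtype.ext ?_))
        exact inv_smul_smul g (γ t : OnePoint ℂ)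
    exact (congrArg (fun G => χ (MulOpposite.op G)) key).symm
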